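/- A permutation is a pair $\pi=(S,P)$, where $S=S(\pi)$ is a finite set of positive integers and $P:S\to\mathbb{N}^2$ is an injection such that no two points of $P(S)$ have the same $x$-coordinate or the same $y$-coordinate; its length is $|\pi|=|S|$. It is reduced if, with $n=|\pi|$, $S=[n]$ and $P(S)\subseteq[n]\times[n]$. A permutation $\sigma$ is a subpattern of $\pi$ if there is a map $\phi:S(\sigma)\to S(\pi)$ such that, for all $p,p'\in S(\sigma)$, the point of $p$ in $\sigma$ has a smaller $x$-coordinate (resp. $y$-coordinate) than the point of $p'$ if and only if the point of $\phi(p)$ in $\pi$ has a smaller $x$-coordinate (resp. $y$-coordinate) than the point of $\phi(p')$. The Permutation Pattern problem asks, for two given reduced permutations $\sigma$ and $\pi$, each represented as the array of its points, whether $\sigma$ is a subpattern of $\pi$. Theorem. Permutation Pattern can be solved in time $n^{\ell/2+o(\ell)}$ and polynomial space, where $\ell=|\sigma|$ and $n=|\pi|$. That is, there are a single program of a random access machine (with unit-cost addition, truncated subtraction, comparison and indirect addressing on non-negative integers), a constant $C$, a function $f$ with $f(\ell)=o(\ell)$ as $\ell\to\infty$, and a polynomial $s$, such that on every instance $(\sigma,\pi)$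 the program halts with the correct answer; it does so after at most $C\,n^{\ell/2+f(\ell)}$ steps if $n\ge 1$; and throughout the run all words it holds are at most $s(\ell+n)$ and only memory cells with address below $s(\ell+n)$ are nonzero (so that it uses polynomially many words of $O(\log(\ell+n+2))$ bits each). -/

import Mathlib

open Filter Asymptotics

/-! ### Permutations as labelled point sets -/

/-- A permutation: a finite set `S` of positive integers together with an injection `P` of `S` into
the points of `ℕ × ℕ`, whose image is in general position (no two points have the same
x-coordinate or the same y-coordinate). The values of `P` outside `S` are irrelevant. -/
structure PointPerm where
  S : Finset ℕ
  S_pos : ∀ p ∈ S, 0 < p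
  P : ℕ → ℕ × ℕ
  injOn_fst : ∀ p ∈ S, ∀ q ∈ S, (P p).1 = (P q).1 → p = q
  injOn_snd : ∀ p ∈ S, ∀ q ∈ S, (P p).2 = (P q).2 → p = q

namespace PointPerm

/-- The length of a permutation. -/
def length (π : PointPerm) : ℕ := π.S.card

/-- A map `φ : S(σ) → S(π)` is an embedding of `σ` into `π` if it preserves and reflects the strict
orders of the elements by x-coordinate and by y-coordinate. -/
def IsEmbedding (σ π : PointPerm) (φ : σ.S → π.S) : Prop :=
  ∀ p q : σ.S,
    ((σ.P p).1 < (σ.P q).1 ↔ (π.P (φ p)).1 < (π.P (φ q)).1) ∧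
    ((σ.P p).2 < (σ.P q).2 ↔ (π.P (φ p)).2 < (π.P (φ q)).2)

/-- `σ` is a subpattern of `π`. -/
def IsSubpattern (σ π : PointPerm) : Prop :=
  ∃ φ : σ.S → π.S, IsEmbedding σ π φ

/-- A permutation of length `n` is reduced if `S = [n]` and `P(S) ⊆ [n] × [n]`. -/
def IsReduced (π : PointPerm) : Prop :=
  π.S = Finset.Icc 1 π.length ∧
    ∀ p ∈ π.S, (π.P p).1 ∈ Finset.Icc 1 π.length ∧ (π.P p).2 ∈ Finset.Icc 1 π.length

/-- The array of the points of a reduced permutation of length `n`: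
`x₁, y₁, x₂, y₂, …, xₙ, yₙ`, where `(xᵢ, yᵢ) = P(i)`. -/
def toArray (π : PointPerm) : List ℕ :=
  (List.range π.length).flatMap fun i => [(π.P (i + 1)).1, (π.P (i + 1)).2]

/-- The input of an algorithm for Permutation Pattern: the two lengths, then the two arrays. -/
def encodeInstance (σ π : PointPerm) : List ℕ :=
  σ.length :: π.length :: (σ.toArray ++ π.toArray)

end PointPerm

/-! ### Random access machines -/

namespace RAM

/-- The instructions of a random access machine. Registers are named by constants; the memory is
accessed only indirectly, through an address held in a register. -/
inductive Instr
  /-- register `r` := the constant `k` -/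
  | const (r k : ℕ)
  /-- register `r` := register `a` -/
  | copy (r a : ℕ)
  /-- register `r` := register `a` + register `b` -/
  | add (r a b : ℕ)
  /-- register `r` := max (register `a` - register `b`) 0 -/
  | sub (r a b : ℕ)
  /-- register `r` := the memory cell whose address is in register `a` -/
  | load (r a : ℕ)
  /-- the memory cell whose address is in register `a` := register `r` -/
  | store (a r : ℕ)
  /-- continue at instruction `k` -/
  | jump (k : ℕ)
  /-- continue at instruction `k` if register `a` < register `b`, else at the next one -/
  | jumpLt (a b k : ℕ)
  /-- stop with answer `ans` -/
  | halt (ans : Bool)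

/-- A program is a finite list of instructions, numbered from `0`. -/
abbrev Program := List Instr

/-- A configuration: the program counter, the registers and the memory. -/
structure Config where
  pc : ℕ
  reg : ℕ → ℕ
  mem : ℕ → ℕ

/-- The initial configuration: the input stands in the memory cells `0, 1, 2, …`; everything else
is `0`. -/
def init (input : List ℕ) : Config where
  pc := 0
  reg := fun _ => 0
  mem := fun a => input.getD a 0

/-- Write a value to a register and go on to the next instruction. -/
def Config.setReg (c : Config) (r v : ℕ) : Config where
  pc := c.pc + 1
  reg := Function.update c.reg r v
  mem := c.mem

/-- The effect of one instruction. -/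
def Instr.exec : Instr → Config → Config
  | .const r k, c => c.setReg r k
  | .copy r a, c => c.setReg r (c.reg a)
  | .add r a b, c => c.setReg r (c.reg a + c.reg b)
  | .sub r a b, c => c.setReg r (c.reg a - c.reg b)
  | .load r a, c => c.setReg r (c.mem (c.reg a))
  | .store a r, c => ⟨c.pc + 1, c.reg, Function.update c.mem (c.reg a) (c.reg r)⟩
  | .jump k, c => ⟨k, c.reg, c.mem⟩
  | .jumpLt a b k, c => ⟨if c.reg a < c.reg b then k else c.pc + 1, c.reg, c.mem⟩
  | .halt _, c => c

/-- One step of a program. A configuration at a `halt` instruction (or outside the program) does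
not change any more. -/
def step (prog : Program) (c : Config) : Config :=
  match prog[c.pc]? with
  | some i => i.exec c
  | none => c

/-- The configuration after `t` steps on the given input. -/
def configAt (prog : Program) (input : List ℕ) (t : ℕ) : Config :=
  (step prog)^[t] (init input)

/-- The program, run on the given input, has halted with answer `ans` after `t` steps. -/
def HaltsWithin (prog : Program) (input : List ℕ) (t : ℕ) (ans : Bool) : Prop :=
  prog[(configAt prog input t).pc]? = some (Instr.halt ans)

/-- A configuration fits in space `s`: only the memory cells with address below `s` are in use, and
every word (in a register or in the memory) is at most `s`. For `s` polynomial in the input size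
`N`, this means polynomially many words of `O(log N)` bits each. -/
def Config.FitsIn (c : Config) (s : ℕ) : Prop :=
  (∀ r, c.reg r ≤ s) ∧ (∀ a, c.mem a ≤ s) ∧ (∀ a, s ≤ a → c.mem a = 0)

/-- The program, run on the given input, uses space at most `s` throughout. -/
def RunsInSpace (prog : Program) (input : List ℕ) (s : ℕ) : Prop :=
  ∀ t, (configAt prog input t).FitsIn s

end RAM

/-! Guess the x-coordinates in the text of the ⌊ℓ/2⌋ pattern elements with even x-coordinate; there
are n^⌊ℓ/2⌋ guesses `d`. A guess confines every pattern element to an open vertical strip: the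
element with x-coordinate 2k to the single column d k, the one with x-coordinate 2k+1 to the columns
strictly between d k and d (k+1), with sentinels 0 and n+1 at the two ends. Strips of horizontally
adjacent elements are disjoint and ordered from left to right, so any choice of one text point per
strip has the right horizontal order, and a guess that is not increasing merely produces an empty
strip.

Only the vertical order remains, and it is settled greedily: go through the pattern from bottom to
top and always take the lowest point of the strip above the point taken last. A lower last point
never excludes a later choice, so greed fails only if the guess cannot be completed. Patterns longer
than the text are rejected at once; otherwise a guess costs O(n²) steps, and n^(⌊ℓ/2⌋+2) is within
the bound with the constant f = 2. Beyond the input, memory holds only the digits of the current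
guess.

The combinatorial core is `Data.StrictEmbedding.success` (an embedding yields a guess that can be
completed) and `Success.exists_strictEmbedding` (the converse). On the machine side, `WP` bundles
termination, running time, space and postcondition of a structured command; `wp_testGuess` verifies
the greedy test, `wp_nextGuess` the passage to the next guess, `wp_tryAll` the enumeration, and
`WP.haltsWithin` transfers the result to the compiled program. -/

namespace RAM

/-! ### A structured language compiled to random access machines -/

/-- The registers and the memory, without the program counter. -/
structure State where
  reg : ℕ → ℕ
  mem : ℕ → ℕ

/-- The configuration at instruction `k` in the given state. -/
def State.at (st : State) (k : ℕ) : Config := ⟨k, st.reg, st.mem⟩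

/-- Write a register. -/
def State.set (st : State) (r v : ℕ) : State := ⟨Function.update st.reg r v, st.mem⟩

/-- Write a memory cell. -/
def State.write (st : State) (a v : ℕ) : State := ⟨st.reg, Function.update st.mem a v⟩

/-- The state fits in space `s`. -/
def State.Fits (st : State) (s : ℕ) : Prop :=
  (∀ r, st.reg r ≤ s) ∧ (∀ a, st.mem a ≤ s) ∧ (∀ a, s ≤ a → st.mem a = 0)

theorem State.Fits.set {st : State} {s : ℕ} (h : st.Fits s) (r : ℕ) {v : ℕ} (hv : v ≤ s) :
    (st.set r v).Fits s := by
  refine ⟨fun q => ?_, h.2⟩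
  by_cases hq : q = r
  · subst hq; simpa [State.set] using hv
  · simpa [State.set, hq] using h.1 q

theorem State.Fits.write {st : State} {s : ℕ} (h : st.Fits s) {a v : ℕ} (ha : a < s)
    (hv : v ≤ s) : (st.write a v).Fits s := by
  refine ⟨h.1, fun q => ?_, fun q hq => ?_⟩
  · by_cases hqa : q = a
    · subst hqa; simpa [State.write] using hv
    · simpa [State.write, hqa] using h.2.1 q
  · have hqa : q ≠ a := by omega
    simpa [State.write, hqa] using h.2.2 q hq

/-- Structured commands. Conditions have the form `register a < register b`. -/
inductive Cmd
  | block (is : List Instr)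
  | seq (c₁ c₂ : Cmd)
  | ite (a b : ℕ) (c₁ c₂ : Cmd)
  | loop (a b : ℕ) (c : Cmd)

namespace Cmd

/-- The number of instructions of the compiled command. -/
def size : Cmd → ℕ
  | block is => is.length
  | seq c₁ c₂ => c₁.size + c₂.size
  | ite _ _ c₁ c₂ => 1 + (c₂.size + (1 + c₁.size))
  | loop _ _ c => 2 + (c.size + 1)

/-- The machine code of a command, to be placed at instruction `k`. -/
def compile : Cmd → ℕ → List Instr
  | block is, _ => is
  | seq c₁ c₂, k => c₁.compile k ++ c₂.compile (k + c₁.size)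
  | ite a b c₁ c₂, k =>
      .jumpLt a b (k + 1 + c₂.size + 1) :: (c₂.compile (k + 1) ++
        .jump (k + (1 + (c₂.size + (1 + c₁.size)))) :: c₁.compile (k + 1 + c₂.size + 1))
  | loop a b c, k =>
      .jumpLt a b (k + 2) :: .jump (k + (2 + (c.size + 1))) :: (c.compile (k + 2) ++ [.jump k])

theorem length_compile (c : Cmd) (k : ℕ) : (c.compile k).length = c.size := by
  induction c generalizing k with
  | block is => rfl
  | seq c₁ c₂ h₁ h₂ => simp [compile, size, h₁, h₂]
  | ite a b c₁ c₂ h₁ h₂ => simp [compile, size, h₁, h₂]; omega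
  | loop a b c h => simp [compile, size, h]; omega

end Cmd

/-- The given code stands in the program from instruction `k` on. -/
def CodeAt (prog : Program) : ℕ → List Instr → Prop
  | _, [] => True
  | k, i :: is => prog[k]? = some i ∧ CodeAt prog (k + 1) is

theorem codeAt_append {prog : Program} {k : ℕ} {is js : List Instr} :
    CodeAt prog k (is ++ js) ↔ CodeAt prog k is ∧ CodeAt prog (k + is.length) js := by
  induction is generalizing k with
  | nil => simp [CodeAt]
  | cons i is ih =>
    simp only [List.cons_append, CodeAt, ih, List.length_cons, and_assoc]
    rw [show k + 1 + is.length = k + (is.length + 1) by omega]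

theorem codeAt_self_append (is js : List Instr) : CodeAt (is ++ js) is.length js := by
  induction js generalizing is with
  | nil => trivial
  | cons j js ih =>
    refine ⟨by simp, ?_⟩
    have := ih (is ++ [j])
    simpa using this

/-- The program leads from `c` to `c'` in `t` steps, within space `s`. -/
def Steps (prog : Program) (s : ℕ) (c : Config) (t : ℕ) (c' : Config) : Prop :=
  (∀ i ≤ t, ((step prog)^[i] c).FitsIn s) ∧ (step prog)^[t] c = c'

theorem Steps.trans {prog : Program} {s t t' : ℕ} {c c' c'' : Config}
    (h : Steps prog s c t c') (h' : Steps prog s c' t' c'') :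
    Steps prog s c (t + t') c'' := by
  have key : ∀ j, (step prog)^[t + j] c = (step prog)^[j] c' := fun j => by
    rw [Nat.add_comm, Function.iterate_add_apply, h.2]
  refine ⟨fun i hi => ?_, (key t').trans h'.2⟩
  rcases le_total i t with hit | hit
  · exact h.1 i hit
  · obtain ⟨j, rfl⟩ := Nat.exists_eq_add_of_le hit
    rw [key]
    exact h'.1 j (by omega)

theorem Steps.refl {prog : Program} {s k : ℕ} {st : State} (h : st.Fits s) :
    Steps prog s (st.at k) 0 (st.at k) :=
  ⟨fun i hi => by obtain rfl : i = 0 := by omega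
                  exact h, rfl⟩

theorem Steps.one {prog : Program} {s k k' : ℕ} {st st' : State} {i : Instr}
    (hi : prog[k]? = some i) (h : st.Fits s) (h' : st'.Fits s)
    (he : i.exec (st.at k) = st'.at k') : Steps prog s (st.at k) 1 (st'.at k') := by
  have hs : step prog (st.at k) = st'.at k' := by
    have hk : (st.at k).pc = k := rfl
    rw [step, hk, hi]
    exact he
  refine ⟨fun j hj => ?_, hs⟩
  obtain rfl | rfl : j = 0 ∨ j = 1 := by omega
  · exact h
  · rw [Function.iterate_one, hs]; exact h'

/-- Started in `st`, the command ends within space `s`, after a number `t` of steps and in a state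
`st'` such that `Q st' t`. -/
def WP (s : ℕ) (c : Cmd) (st : State) (Q : State → ℕ → Prop) : Prop :=
  ∀ (prog : Program) (k : ℕ), CodeAt prog k (c.compile k) →
    ∃ t st', Steps prog s (st.at k) t (st'.at (k + c.size)) ∧ Q st' t

/-- The effect of a straight-line instruction. -/
def Instr.run : Instr → State → State
  | .const r k, st => st.set r k
  | .copy r a, st => st.set r (st.reg a)
  | .add r a b, st => st.set r (st.reg a + st.reg b)
  | .sub r a b, st => st.set r (st.reg a - st.reg b)
  | .load r a, st => st.set r (st.mem (st.reg a))
  | .store a r, st => st.write (st.reg a) (st.reg r)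
  | _, st => st

/-- What has to be checked for a straight-line instruction to stay within space `s`. -/
def Instr.Safe (s : ℕ) : Instr → State → Prop
  | .const _ k, _ => k ≤ s
  | .copy _ _, _ => True
  | .add _ a b, st => st.reg a + st.reg b ≤ s
  | .sub _ _ _, _ => True
  | .load _ _, _ => True
  | .store a _, st => st.reg a < s
  | _, _ => False

/-- The effect of a list of straight-line instructions. -/
def runAll : List Instr → State → State
  | [], st => st
  | i :: is, st => runAll is (i.run st)

/-- What has to be checked for a list of straight-line instructions to stay within space `s`. -/
def SafeAll (s : ℕ) : List Instr → State → Prop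
  | [], _ => True
  | i :: is, st => i.Safe s st ∧ SafeAll s is (i.run st)

theorem Instr.Safe.exec {s : ℕ} {i : Instr} {st : State} (hi : i.Safe s st) (h : st.Fits s)
    (k : ℕ) : (i.run st).Fits s ∧ i.exec (st.at k) = (i.run st).at (k + 1) := by
  cases i with
  | const r v => exact ⟨h.set r hi, rfl⟩
  | copy r a => exact ⟨h.set r (h.1 a), rfl⟩
  | add r a b => exact ⟨h.set r hi, rfl⟩
  | sub r a b => exact ⟨h.set r ((Nat.sub_le _ _).trans (h.1 a)), rfl⟩
  | load r a => exact ⟨h.set r (h.2.1 _), rfl⟩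
  | store a r => exact ⟨h.write hi (h.1 r), rfl⟩
  | jump k => exact hi.elim
  | jumpLt a b k => exact hi.elim
  | halt b => exact hi.elim

theorem WP.mono {s : ℕ} {c : Cmd} {st : State} {Q Q' : State → ℕ → Prop} (h : WP s c st Q)
    (hQ : ∀ st' t, Q st' t → Q' st' t) : WP s c st Q' := fun prog k hc => by
  obtain ⟨t, st', hs, hq⟩ := h prog k hc
  exact ⟨t, st', hs, hQ _ _ hq⟩

theorem WP.block {s : ℕ} {is : List Instr} {st : State} {Q : State → ℕ → Prop} (h : st.Fits s)
    (hs : SafeAll s is st) (hQ : (runAll is st).Fits s → Q (runAll is st) is.length) :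
    WP s (.block is) st Q := by
  suffices H : ∀ (prog : Program) (k : ℕ), CodeAt prog k is →
      (runAll is st).Fits s ∧ Steps prog s (st.at k) is.length ((runAll is st).at (k + is.length)) from
    fun prog k hc => ⟨_, _, (H prog k hc).2, hQ (H prog k hc).1⟩
  clear hQ
  induction is generalizing st with
  | nil => exact fun prog k _ => ⟨h, Steps.refl h⟩
  | cons i is ih =>
    intro prog k hc
    obtain ⟨hf, he⟩ := hs.1.exec h k
    obtain ⟨hf', hst⟩ := ih hf hs.2 prog (k + 1) hc.2
    refine ⟨hf', ?_⟩
    have := (Steps.one hc.1 h hf he).trans hst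
    rwa [Nat.add_comm 1, Nat.add_assoc, Nat.add_comm 1] at this

theorem WP.seq {s : ℕ} {c₁ c₂ : Cmd} {st : State} {Q : State → ℕ → Prop}
    (h : WP s c₁ st fun st₁ t₁ => WP s c₂ st₁ fun st₂ t₂ => Q st₂ (t₁ + t₂)) :
    WP s (.seq c₁ c₂) st Q := fun prog k hc => by
  rw [Cmd.compile, codeAt_append, Cmd.length_compile] at hc
  obtain ⟨t₁, st₁, hs₁, h₁⟩ := h prog k hc.1
  obtain ⟨t₂, st₂, hs₂, h₂⟩ := h₁ prog _ hc.2
  exact ⟨_, _, by simpa [Cmd.size, Nat.add_assoc] using hs₁.trans hs₂, h₂⟩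

/-- The second branch costs two extra steps: the failed test and the jump over the code of the first
branch. That last jump happens in the final state, and `hQ` is what guarantees that this state fits.
-/
theorem WP.ite {s a b : ℕ} {c₁ c₂ : Cmd} {st : State} {Q : State → ℕ → Prop} (h : st.Fits s)
    (hQ : ∀ st' t, Q st' t → st'.Fits s)
    (h₁ : st.reg a < st.reg b → WP s c₁ st fun st' t => Q st' (t + 1))
    (h₂ : st.reg b ≤ st.reg a → WP s c₂ st fun st' t => Q st' (t + 2)) :
    WP s (.ite a b c₁ c₂) st Q := fun prog k hc => by
  simp only [Cmd.compile, CodeAt, codeAt_append, Cmd.length_compile] at hc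
  obtain ⟨hj, hc₂, hj', hc₁⟩ := hc
  rcases lt_or_ge (st.reg a) (st.reg b) with hlt | hge
  · obtain ⟨t, st', hs, hq⟩ := h₁ hlt prog _ hc₁
    refine ⟨t + 1, st', ?_, hq⟩
    have := (Steps.one hj h h (k' := k + 1 + c₂.size + 1)
      (by simp [Instr.exec, State.at, hlt])).trans hs
    rw [Nat.add_comm t]
    convert this using 2
    simp only [Cmd.size]; omega
  · obtain ⟨t, st', hs, hq⟩ := h₂ hge prog _ hc₂
    refine ⟨t + 2, st', ?_, hq⟩
    have h1 := (Steps.one hj h h (k' := k + 1)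
      (by simp [Instr.exec, State.at, hge.not_gt])).trans hs
    have h2 := h1.trans (Steps.one hj' (hQ _ _ hq) (hQ _ _ hq) rfl)
    rwa [show 1 + t + 1 = t + 2 by omega] at h2

/-- The rule for loops: at most `K` rounds of at most `T` steps each, with an invariant indexed by
the number of rounds. -/
theorem WP.loop {s a b : ℕ} {c : Cmd} {Q : State → Prop} (Inv : ℕ → State → Prop) (K T : ℕ)
    (hF : ∀ i st, Inv i st → st.Fits s)
    (hI : ∀ i st, Inv i st → (st.reg b ≤ st.reg a ∧ Q st) ∨
      (st.reg a < st.reg b ∧ i < K ∧ WP s c st fun st' t => t ≤ T ∧ Inv (i + 1) st'))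
    {st : State} (h : Inv 0 st) :
    WP s (.loop a b c) st fun st' t => t ≤ K * (T + 2) + 2 ∧ Q st' := fun prog k hc => by
  simp only [Cmd.compile, CodeAt, codeAt_append, Cmd.length_compile] at hc
  obtain ⟨hj, hj', hc, hj'', -⟩ := hc
  -- Here `m` bounds the rounds still possible. A round costs its body, the test and the jump back;
  -- leaving costs the failed test and the jump out.
  suffices H : ∀ m i st, K - i ≤ m → Inv i st → ∃ t st',
      Steps prog s (st.at k) t (st'.at (k + (Cmd.loop a b c).size)) ∧
        t ≤ m * (T + 2) + 2 ∧ Q st' from H K 0 st (by omega) h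
  intro m
  induction m with
  | zero =>
    intro i st hm hi
    rcases hI i st hi with ⟨hge, hq⟩ | ⟨-, hK, -⟩
    · refine ⟨2, st, ?_, by omega, hq⟩
      exact (Steps.one hj (hF _ _ hi) (hF _ _ hi) (k' := k + 1)
        (by simp [Instr.exec, State.at, hge.not_gt])).trans
        (Steps.one hj' (hF _ _ hi) (hF _ _ hi) rfl)
    · omega
  | succ m ih =>
    intro i st hm hi
    rcases hI i st hi with ⟨hge, hq⟩ | ⟨hlt, hK, hw⟩
    · refine ⟨2, st, ?_, by omega, hq⟩
      exact (Steps.one hj (hF _ _ hi) (hF _ _ hi) (k' := k + 1)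
        (by simp [Instr.exec, State.at, hge.not_gt])).trans
        (Steps.one hj' (hF _ _ hi) (hF _ _ hi) rfl)
    · obtain ⟨t, st', hs, ht, hi'⟩ := hw prog _ hc
      obtain ⟨t', st'', hs', ht', hq⟩ := ih (i + 1) st' (by omega) hi'
      have h1 := (Steps.one hj (hF _ _ hi) (hF _ _ hi) (k' := k + 2)
        (by simp [Instr.exec, State.at, hlt])).trans hs
      have h2 := h1.trans (Steps.one hj'' (hF _ _ hi') (hF _ _ hi') rfl)
      refine ⟨_, st'', h2.trans hs', ?_, hq⟩
      rw [Nat.succ_mul]; omega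

/-- A command followed by the answer: `true` if register `r` is positive. -/
def Cmd.withAnswer (c : Cmd) (r : ℕ) : Program :=
  c.compile 0 ++ [.jumpLt 0 r (c.size + 2), .halt false, .halt true]

/-- From the behaviour of a command to that of the program that ends with its answer. -/
theorem WP.haltsWithin {s r : ℕ} {c : Cmd} {input : List ℕ} {Q : ℕ → ℕ → Prop}
    (h : WP s c ⟨fun _ => 0, fun a => input.getD a 0⟩ fun st t =>
      st.Fits s ∧ st.reg 0 = 0 ∧ Q (st.reg r) t) :
    (∃ t v, Q v t ∧ HaltsWithin (c.withAnswer r) input (t + 1) (decide (0 < v))) ∧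
      RunsInSpace (c.withAnswer r) input s := by
  have hcode : CodeAt (c.withAnswer r) 0 (c.withAnswer r) := codeAt_self_append [] _
  rw [Cmd.withAnswer, codeAt_append, Cmd.length_compile, ← Cmd.withAnswer, Nat.zero_add] at hcode
  obtain ⟨hc, hj, hf, ht, -⟩ := hcode
  obtain ⟨t, st, hs, hfit, h0, hq⟩ := h _ 0 hc
  rw [Nat.zero_add] at hs
  -- Register 0 holds 0, so the final comparison tests whether register `r` is positive.
  have hlast := hs.trans (Steps.one hj hfit hfit
    (k' := if 0 < st.reg r then c.size + 2 else c.size + 1) (by simp [Instr.exec, State.at, h0]))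
  have hhalt : (c.withAnswer r)[(st.at (if 0 < st.reg r then c.size + 2 else c.size + 1)).pc]? =
      some (.halt (decide (0 < st.reg r))) := by
    by_cases hr : 0 < st.reg r
    · simpa [State.at, hr] using ht
    · simpa [State.at, hr] using hf
  refine ⟨⟨t, st.reg r, hq, ?_⟩, fun u => ?_⟩
  · rw [HaltsWithin, configAt]
    erw [hlast.2]
    exact hhalt
  · rcases le_total u (t + 1) with hu | hu
    · exact hlast.1 u hu
    · obtain ⟨j, rfl⟩ := Nat.exists_eq_add_of_le hu
      -- A halting configuration is a fixed point of `step`, so the space bound persists for all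
      -- later times.
      have hfix : ∀ j, (step (c.withAnswer r))^[j]
          (st.at (if 0 < st.reg r then c.size + 2 else c.size + 1)) =
          st.at (if 0 < st.reg r then c.size + 2 else c.size + 1) := fun j => by
        refine Function.iterate_fixed ?_ j
        rw [step, hhalt]
        rfl
      have h1 : configAt (c.withAnswer r) input (t + 1 + j) =
          st.at (if 0 < st.reg r then c.size + 2 else c.size + 1) := by
        rw [configAt, Nat.add_comm, Function.iterate_add_apply]
        erw [hlast.2]
        exact hfix j
      rw [h1]
      exact hfit

theorem State.set_reg (st : State) (r v q : ℕ) :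
    (st.set r v).reg q = if q = r then v else st.reg q := by
  simp [State.set, Function.update_apply]

theorem State.set_mem (st : State) (r v : ℕ) : (st.set r v).mem = st.mem := rfl

theorem State.write_reg (st : State) (a v : ℕ) : (st.write a v).reg = st.reg := rfl

theorem State.write_mem (st : State) (a v b : ℕ) :
    (st.write a v).mem b = if b = a then v else st.mem b := by
  simp [State.write, Function.update_apply]

/-- `st'` fits in space `s` and differs from `st` at most in registers from `K` on. -/
structure Same (s K : ℕ) (st st' : State) : Prop where
  fits : st'.Fits s
  mem : st'.mem = st.mem
  reg : ∀ r < K, st'.reg r = st.reg r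

theorem Same.trans {s K K' : ℕ} {st st' st'' : State} (h : Same s K st st')
    (h' : Same s K' st' st'') (hK : K ≤ K') : Same s K st st'' :=
  ⟨h'.fits, h'.mem.trans h.mem, fun r hr => (h'.reg r (by omega)).trans (h.reg r hr)⟩

end RAM

namespace PatternSearch

open RAM

/-! ### Strips, reachable heights and the memory layout -/

/-- The input of the search, as numbers: the points `(X i, Y i)`, `i < l`, of the pattern and the
points `(U q, V q)`, `q < n`, of the text. -/
structure Data where
  l : ℕ
  n : ℕ
  X : ℕ → ℕ
  Y : ℕ → ℕ
  U : ℕ → ℕ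
  V : ℕ → ℕ

/-- The properties of the input that the search relies on. -/
structure Data.Valid (I : Data) : Prop where
  X_mem : ∀ i < I.l, 1 ≤ I.X i ∧ I.X i ≤ I.l
  Y_inj : ∀ i < I.l, ∀ i' < I.l, I.Y i = I.Y i' → i = i'
  Y_surj : ∀ v < I.l, ∃ i < I.l, I.Y i = v + 1
  V_le : ∀ q < I.n, I.V q ≤ I.n

/-- The space bound. -/
def Data.space (I : Data) : ℕ := 10 * (I.l + I.n) + 20

/-- The first memory cell after the input. -/
def Data.base (I : Data) : ℕ := 2 + 2 * I.l + 2 * I.n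

/-- Lower end of the open strip for the pattern element with x-coordinate `j`, when the elements
with x-coordinate `2 * k` are placed at x-coordinate `d k`. -/
def lo (d : ℕ → ℕ) (j : ℕ) : ℕ := if j % 2 = 0 then d (j / 2) - 1 else d (j / 2)

/-- Upper end of the open strip for the pattern element with x-coordinate `j`. -/
def hi (d : ℕ → ℕ) (j : ℕ) : ℕ := if j % 2 = 0 then d (j / 2) + 1 else d (j / 2 + 1)

/-- The pattern elements with y-coordinates `1, …, v` can be placed in their strips, with
increasing y-coordinates the last of which is `c`. -/
def Reach (I : Data) (d : ℕ → ℕ) : ℕ → ℕ → Prop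
  | 0, c => c = 0
  | v + 1, c => ∃ c', Reach I d v c' ∧ ∃ i < I.l, I.Y i = v + 1 ∧
      ∃ q < I.n, c' < I.V q ∧ lo d (I.X i) < I.U q ∧ I.U q < hi d (I.X i) ∧ I.V q = c

/-- Constants and input are in place. Register `0` holds `0`, `1` holds `1`, `2` and `3` hold the
lengths, `4` and `5` the addresses of the text and of the free memory, `6` holds `n + 1`, and `7`
the address of the last digit. -/
structure Ctx (I : Data) (st : State) : Prop where
  fits : st.Fits I.space
  r0 : st.reg 0 = 0
  r1 : st.reg 1 = 1
  r2 : st.reg 2 = I.l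
  r3 : st.reg 3 = I.n
  r4 : st.reg 4 = 2 + 2 * I.l
  r5 : st.reg 5 = I.base
  r6 : st.reg 6 = I.n + 1
  r7 : st.reg 7 = I.base + I.l / 2 + 1
  mX : ∀ i < I.l, st.mem (2 + 2 * i) = I.X i
  mY : ∀ i < I.l, st.mem (2 + 2 * i + 1) = I.Y i
  mU : ∀ q < I.n, st.mem (2 + 2 * I.l + 2 * q) = I.U q
  mV : ∀ q < I.n, st.mem (2 + 2 * I.l + 2 * q + 1) = I.V q

/-- The digits stand in the free memory. -/
def Digits (I : Data) (d : ℕ → ℕ) (st : State) : Prop :=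
  ∀ k ≤ I.l / 2 + 1, st.mem (I.base + k) = d k

theorem Ctx.of_same {I : Data} {st st' : State} (h : Ctx I st) {K : ℕ}
    (hs : Same I.space K st st') (hK : 8 ≤ K) : Ctx I st' where
  fits := hs.fits
  r0 := by rw [hs.reg _ (by omega), h.r0]
  r1 := by rw [hs.reg _ (by omega), h.r1]
  r2 := by rw [hs.reg _ (by omega), h.r2]
  r3 := by rw [hs.reg _ (by omega), h.r3]
  r4 := by rw [hs.reg _ (by omega), h.r4]
  r5 := by rw [hs.reg _ (by omega), h.r5]
  r6 := by rw [hs.reg _ (by omega), h.r6]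
  r7 := by rw [hs.reg _ (by omega), h.r7]
  mX := by rw [hs.mem]; exact h.mX
  mY := by rw [hs.mem]; exact h.mY
  mU := by rw [hs.mem]; exact h.mU
  mV := by rw [hs.mem]; exact h.mV

theorem Digits.of_same {I : Data} {d : ℕ → ℕ} {st st' : State} (h : Digits I d st) {s K : ℕ}
    (hs : Same s K st st') : Digits I d st' := by
  rw [Digits, hs.mem]; exact h

/-! ### Placing one pattern element -/

/-- Read the next point at address `12` into registers `13` and `14`. -/
def readPoint : List Instr := [.load 13 12, .add 12 12 1, .load 14 12, .add 12 12 1]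

/-- Register `15` := the x-coordinate of the pattern element whose y-coordinate is in register
`10`. -/
def findElement : Cmd :=
  .seq (.block [.const 12 2]) <| .loop 12 4 <| .seq (.block readPoint) <|
    .ite 14 10 (.block []) <| .ite 10 14 (.block []) <| .block [.copy 15 13]

/-- Registers `18` and `19` := the ends of the strip for x-coordinate `j` in register `15`. -/
def findStrip : Cmd :=
  .seq (.block [.copy 16 5, .const 17 1]) <|
  .seq (.loop 17 15 (.block [.add 16 16 1, .add 17 17 1, .add 17 17 1])) <|
  .seq (.block [.load 18 16]) <|
  .ite 15 17 (.block [.add 19 18 1, .sub 18 18 1]) (.block [.add 16 16 1, .load 19 16])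

/-- Register `20` := the least y-coordinate above register `11` in the strip. -/
def scanStrip : Cmd :=
  .seq (.block [.copy 20 6, .copy 12 4]) <| .loop 12 5 <| .seq (.block readPoint) <|
    .ite 18 13 (.ite 13 19 (.ite 11 14 (.ite 14 20 (.block [.copy 20 14])
      (.block [])) (.block [])) (.block [])) (.block [])

theorem wp_readPoint {s p x y : ℕ} {st : State} {Q : State → ℕ → Prop} (h : st.Fits s)
    (h1 : st.reg 1 = 1) (hp : st.reg 12 = p) (hx : st.mem p = x) (hy : st.mem (p + 1) = y)
    (hps : p + 2 ≤ s)
    (hQ : ∀ st' : State, st'.Fits s → st'.mem = st.mem →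
      (∀ r, r ≠ 12 → r ≠ 13 → r ≠ 14 → st'.reg r = st.reg r) → st'.reg 12 = p + 2 →
      st'.reg 13 = x → st'.reg 14 = y → Q st' 4) :
    WP s (.block readPoint) st Q := by
  refine WP.block h ?_ fun hF => hQ _ hF ?_ ?_ ?_ ?_ ?_
  · simp [readPoint, SafeAll, Instr.Safe, Instr.run, State.set_reg, h1, hp]
    omega
  · simp [readPoint, runAll, Instr.run, State.set_mem]
  · intro r h12 h13 h14
    simp [readPoint, runAll, Instr.run, State.set_reg, h12, h13, h14]
  · simp [readPoint, runAll, Instr.run, State.set_reg, h1, hp]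
  · simp [readPoint, runAll, Instr.run, State.set_reg, hp, hx]
  · simp [readPoint, runAll, Instr.run, State.set_reg, State.set_mem, hp, h1, hy]

theorem wp_skip {s : ℕ} {st : State} {Q : State → ℕ → Prop} (h : st.Fits s) (hQ : Q st 0) :
    WP s (.block []) st Q := WP.block h trivial fun _ => hQ

theorem wp_findElement {I : Data} (hI : I.Valid) {st : State} (h : Ctx I st) :
    WP I.space findElement st fun st' t => t ≤ 14 * I.l + 3 ∧ Same I.space 12 st st' ∧
      ∀ i < I.l, I.Y i = st.reg 10 → st'.reg 15 = I.X i := by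
  have hspace : I.space = 10 * (I.l + I.n) + 20 := rfl
  refine WP.seq (WP.block h.fits ?_ fun hF => ?_)
  · simp [SafeAll, Instr.Safe]; omega
  let Inv : ℕ → State → Prop := fun c st' => Same I.space 12 st st' ∧ c ≤ I.l ∧
    st'.reg 12 = 2 + 2 * c ∧ ∀ i < c, I.Y i = st.reg 10 → st'.reg 15 = I.X i
  refine (WP.loop (Q := Inv I.l) Inv I.l 12 (fun i st' hi => hi.1.fits) ?_ ?_).mono ?_
  · rintro c st1 ⟨hs, hc, h12, hj⟩
    have hC := h.of_same hs (by norm_num)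
    rcases hc.eq_or_lt with rfl | hlt
    · left
      rw [hC.r4, h12]
      exact ⟨le_rfl, hs, le_rfl, h12, hj⟩
    right
    rw [hC.r4, h12]
    refine ⟨by omega, hlt, WP.seq (wp_readPoint hs.fits hC.r1 h12 (hC.mX c hlt) (hC.mY c hlt)
      (by omega) fun st2 hF2 hm2 hr2 hp2 hx2 hy2 => ?_)⟩
    have h10 : st2.reg 10 = st.reg 10 := by
      rw [hr2 _ (by norm_num) (by norm_num) (by norm_num), hs.reg _ (by norm_num)]
    have hs2 : Same I.space 12 st st2 := ⟨hF2, hm2.trans hs.mem, fun r hr => by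
      rw [hr2 _ (by omega) (by omega) (by omega), hs.reg _ hr]⟩
    have hskip : I.Y c ≠ st.reg 10 → Inv (c + 1) st2 := fun hne =>
      ⟨hs2, hlt, by rw [hp2]; ring, fun i hi hiY => by
        have : i ≠ c := fun e => hne (e ▸ hiY)
        rw [hr2 _ (by norm_num) (by norm_num) (by norm_num)]
        exact hj i (by omega) hiY⟩
    -- Only strict comparison is available: equality is recognised by the failure of both
    -- comparisons.
    refine WP.ite hF2 (fun st' t hq => hq.2.1.fits) (fun hlt1 => ?_) fun hge1 => ?_
    · exact wp_skip hF2 ⟨by norm_num, hskip (by omega)⟩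
    refine WP.ite hF2 (fun st' t hq => hq.2.1.fits) (fun hlt2 => ?_) fun hge2 => ?_
    · exact wp_skip hF2 ⟨by norm_num, hskip (by omega)⟩
    refine WP.block hF2 (by simp [SafeAll, Instr.Safe]) fun hF3 =>
      ⟨by norm_num, ⟨hF3, ?_, fun r hr => ?_⟩, hlt, ?_, fun i hi hiY => ?_⟩
    · exact hs2.mem
    · have : r ≠ 15 := by omega
      simpa [runAll, Instr.run, State.set_reg, this] using hs2.reg r hr
    · simp [runAll, Instr.run, State.set_reg, hp2]; ring
    · have hic : i = c := hI.Y_inj _ (by omega) _ hlt (by omega)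
      simp [runAll, Instr.run, State.set_reg, hx2, hic]
  · refine ⟨⟨hF, rfl, fun r hr => ?_⟩, by omega, ?_, fun i hi => by omega⟩
    · have : r ≠ 12 := by omega
      simp [runAll, Instr.run, State.set_reg, this]
    · simp [runAll, Instr.run, State.set_reg]
  · rintro st' t ⟨ht, hs, -, -, hj⟩
    exact ⟨by simp only [List.length_cons, List.length_nil]; omega, hs, hj⟩

/-- Halving without division: register `17` runs through 1, 3, 5, … until it is at least `j`, while
register `16` advances one digit per round, so it ends at digit j / 2. Register `17` then exceeds
`j` exactly when `j` is even, which decides the shape of the strip. -/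
theorem wp_findStrip {I : Data} {d : ℕ → ℕ} {st : State} (h : Ctx I st) (hd : Digits I d st)
    (hdn : ∀ k, d k ≤ I.n + 1) {j : ℕ} (hj : st.reg 15 = j) (hj1 : 1 ≤ j) (hjl : j ≤ I.l) :
    WP I.space findStrip st fun st' t => t ≤ 5 * I.l + 9 ∧ Same I.space 16 st st' ∧
      st'.reg 18 = lo d j ∧ st'.reg 19 = hi d j := by
  have hspace : I.space = 10 * (I.l + I.n) + 20 := rfl
  have hbase : I.base = 2 + 2 * I.l + 2 * I.n := rfl
  refine WP.seq (WP.block h.fits ?_ fun hF => ?_)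
  · simp [SafeAll, Instr.Safe]; omega
  let Inv : ℕ → State → Prop := fun c st' => Same I.space 16 st st' ∧ c ≤ j / 2 ∧
    st'.reg 16 = I.base + c ∧ st'.reg 17 = 1 + 2 * c
  refine WP.seq ((WP.loop (Q := Inv (j / 2)) Inv I.l 3 (fun i st' hi => hi.1.fits) ?_ ?_).mono ?_)
  · rintro c st1 ⟨hs, hc, h16, h17⟩
    have h15 : st1.reg 15 = j := by rw [hs.reg _ (by norm_num), hj]
    rw [h15, h17]
    rcases le_or_gt j (1 + 2 * c) with hle | hlt
    · obtain rfl : c = j / 2 := by omega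
      exact Or.inl ⟨hle, hs, le_rfl, h16, h17⟩
    have hC := h.of_same hs (by norm_num)
    refine Or.inr ⟨hlt, by omega, WP.block hs.fits ?_ fun hF2 => ⟨by simp, ⟨hF2, ?_, fun r hr => ?_⟩,
      by omega, ?_, ?_⟩⟩
    · simp [SafeAll, Instr.Safe, Instr.run, State.set_reg, hC.r1, h16, h17]; omega
    · exact hs.mem
    · have h1 : r ≠ 16 := by omega
      have h2 : r ≠ 17 := by omega
      simpa [runAll, Instr.run, State.set_reg, h1, h2] using hs.reg r hr
    · simp [runAll, Instr.run, State.set_reg, hC.r1, h16]; omega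
    · simp [runAll, Instr.run, State.set_reg, hC.r1, h17]; omega
  · refine ⟨⟨hF, rfl, fun r hr => ?_⟩, by omega, ?_, ?_⟩
    · have h1 : r ≠ 16 := by omega
      have h2 : r ≠ 17 := by omega
      simp [runAll, Instr.run, State.set_reg, h1, h2]
    · simp [runAll, Instr.run, State.set_reg, h.r5]
    · simp [runAll, Instr.run, State.set_reg]
  rintro st1 t ⟨ht, hs, -, h16, h17⟩
  have hC := h.of_same hs (by norm_num)
  have hd1 := hd.of_same hs
  have h15 : st1.reg 15 = j := by rw [hs.reg _ (by norm_num), hj]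
  have hk := hd1 (j / 2) (by omega)
  have hk' := hd1 (j / 2 + 1) (by omega)
  refine WP.seq (WP.block hs.fits (by simp [SafeAll, Instr.Safe]) fun hF2 => ?_)
  simp only [List.length_cons, List.length_nil]
  refine WP.ite hF2 (fun st' t hq => hq.2.1.fits) (fun hlt => ?_) fun hge => ?_
  · have hpar : j % 2 = 0 := by
      simp [runAll, Instr.run, State.set_reg, h15, h17] at hlt
      omega
    refine WP.block hF2 ?_ fun hF3 => ⟨by simp; omega, ⟨hF3, hs.mem, fun r hr => ?_⟩, ?_, ?_⟩
    · have := hdn (j / 2)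
      simp [runAll, SafeAll, Instr.Safe, Instr.run, State.set_reg, h16, hk, hC.r1]; omega
    · have h1 : r ≠ 18 := by omega
      have h2 : r ≠ 19 := by omega
      simpa [runAll, Instr.run, State.set_reg, h1, h2] using hs.reg r hr
    · simp [runAll, Instr.run, State.set_reg, h16, hk, hC.r1, lo, hpar]
    · simp [runAll, Instr.run, State.set_reg, h16, hk, hC.r1, hi, hpar]
  · have hpar : j % 2 ≠ 0 := by
      simp [runAll, Instr.run, State.set_reg, h15, h17] at hge
      omega
    refine WP.block hF2 ?_ fun hF3 => ⟨by simp; omega, ⟨hF3, hs.mem, fun r hr => ?_⟩, ?_, ?_⟩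
    · simp [runAll, SafeAll, Instr.Safe, Instr.run, State.set_reg, h16, hC.r1]; omega
    · have h1 : r ≠ 16 := by omega
      have h2 : r ≠ 18 := by omega
      have h3 : r ≠ 19 := by omega
      simpa [runAll, Instr.run, State.set_reg, h1, h2, h3] using hs.reg r hr
    · simp [runAll, Instr.run, State.set_reg, h16, hk, lo, hpar]
    · simp [runAll, Instr.run, State.set_reg, State.set_mem, h16, hC.r1, hi, hpar, Nat.add_assoc,
        hk']

/-- A running minimum in which `n + 1` plays the role of infinity, since all y-coordinates are at
most `n`. The three conclusions say that the result is infinite or attained, bounded by infinity,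
and a lower bound for all candidates. -/
theorem wp_scanStrip {I : Data} (hI : I.Valid) {st : State} (h : Ctx I st) {a b c : ℕ}
    (ha : st.reg 18 = a) (hb : st.reg 19 = b) (hc : st.reg 11 = c) :
    WP I.space scanStrip st fun st' t => t ≤ 16 * I.n + 4 ∧ Same I.space 12 st st' ∧
      (st'.reg 20 = I.n + 1 ∨
        ∃ q < I.n, c < I.V q ∧ a < I.U q ∧ I.U q < b ∧ I.V q = st'.reg 20) ∧
      st'.reg 20 ≤ I.n + 1 ∧
      ∀ q < I.n, c < I.V q → a < I.U q → I.U q < b → st'.reg 20 ≤ I.V q := by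
  have hspace : I.space = 10 * (I.l + I.n) + 20 := rfl
  have hbase : I.base = 2 + 2 * I.l + 2 * I.n := rfl
  refine WP.seq (WP.block h.fits (by simp [SafeAll, Instr.Safe]) fun hF => ?_)
  let Inv : ℕ → State → Prop := fun m st' => Same I.space 12 st st' ∧ m ≤ I.n ∧
    st'.reg 12 = 2 + 2 * I.l + 2 * m ∧ st'.reg 18 = a ∧ st'.reg 19 = b ∧
    (st'.reg 20 = I.n + 1 ∨
        ∃ q < m, c < I.V q ∧ a < I.U q ∧ I.U q < b ∧ I.V q = st'.reg 20) ∧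
    st'.reg 20 ≤ I.n + 1 ∧
      ∀ q < m, c < I.V q → a < I.U q → I.U q < b → st'.reg 20 ≤ I.V q
  refine (WP.loop (Q := Inv I.n) Inv I.n 14 (fun i st' hi => hi.1.fits) ?_ ?_).mono ?_
  · rintro m st1 ⟨hs, hm, h12, h18, h19, hex, hle, hmin⟩
    have hC := h.of_same hs (by norm_num)
    rcases hm.eq_or_lt with rfl | hlt
    · left
      rw [hC.r5, h12, hbase]
      exact ⟨le_rfl, hs, le_rfl, h12, h18, h19, hex, hle, hmin⟩
    right
    rw [hC.r5, h12]
    refine ⟨by omega, hlt, WP.seq (wp_readPoint hs.fits hC.r1 h12 (hC.mU m hlt) (hC.mV m hlt)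
      (by omega) fun st2 hF2 hm2 hr2 hp2 hx2 hy2 => ?_)⟩
    have h11 : st2.reg 11 = c := by
      rw [hr2 _ (by norm_num) (by norm_num) (by norm_num), hs.reg _ (by norm_num), hc]
    have h18' : st2.reg 18 = a := by rw [hr2 _ (by norm_num) (by norm_num) (by norm_num), h18]
    have h19' : st2.reg 19 = b := by rw [hr2 _ (by norm_num) (by norm_num) (by norm_num), h19]
    have h20 : st2.reg 20 = st1.reg 20 := hr2 _ (by norm_num) (by norm_num) (by norm_num)
    have hs2 : Same I.space 12 st st2 := ⟨hF2, hm2.trans hs.mem, fun r hr => by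
      rw [hr2 _ (by omega) (by omega) (by omega), hs.reg _ hr]⟩
    have hskip : ¬ (c < I.V m ∧ a < I.U m ∧ I.U m < b ∧ I.V m < st1.reg 20) →
        Inv (m + 1) st2 := fun hne =>
      ⟨hs2, hlt, by rw [hp2]; ring, h18', h19', by
        rw [h20]
        exact hex.imp_right fun ⟨q, hq, hq'⟩ => ⟨q, by omega, hq'⟩, by rw [h20]; exact hle,
        fun q hq h1 h2 h3 => by
        rw [h20]
        rcases Nat.lt_succ_iff_lt_or_eq.mp hq with hq | rfl
        · exact hmin q hq h1 h2 h3
        · by_contra hh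
          exact hne ⟨h1, h2, h3, by omega⟩⟩
    refine WP.ite hF2 (fun st' t hq => hq.2.1.fits) (fun hlt1 => ?_) fun hge1 => ?_
    swap
    · exact wp_skip hF2 ⟨by norm_num, hskip (by omega)⟩
    refine WP.ite hF2 (fun st' t hq => hq.2.1.fits) (fun hlt2 => ?_) fun hge2 => ?_
    swap
    · exact wp_skip hF2 ⟨by norm_num, hskip (by omega)⟩
    refine WP.ite hF2 (fun st' t hq => hq.2.1.fits) (fun hlt3 => ?_) fun hge3 => ?_
    swap
    · exact wp_skip hF2 ⟨by norm_num, hskip (by omega)⟩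
    refine WP.ite hF2 (fun st' t hq => hq.2.1.fits) (fun hlt4 => ?_) fun hge4 => ?_
    swap
    · exact wp_skip hF2 ⟨by norm_num, hskip (by omega)⟩
    have hVm := hI.V_le m hlt
    have hr20 : (runAll [.copy 20 14] st2).reg 20 = I.V m := by
      simp [runAll, Instr.run, State.set_reg, hy2]
    refine WP.block hF2 (by simp [SafeAll, Instr.Safe]) fun hF3 =>
      ⟨by norm_num, ⟨hF3, hs2.mem, fun r hr => ?_⟩, hlt, ?_, ?_, ?_, ?_, ?_, ?_⟩
    · have : r ≠ 20 := by omega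
      simpa [runAll, Instr.run, State.set_reg, this] using hs2.reg r hr
    · simp [runAll, Instr.run, State.set_reg, hp2]; ring
    · simp [runAll, Instr.run, State.set_reg, h18']
    · simp [runAll, Instr.run, State.set_reg, h19']
    · exact Or.inr ⟨m, by omega, by omega, by omega, by omega, hr20.symm⟩
    · rw [hr20]; omega
    · intro q hq h1 h2 h3
      rw [hr20]
      rcases Nat.lt_succ_iff_lt_or_eq.mp hq with hq | rfl
      · have := hmin q hq h1 h2 h3
        omega
      · exact le_rfl
  · refine ⟨⟨hF, rfl, fun r hr => ?_⟩, by omega, ?_, ?_, ?_, Or.inl ?_, ?_, fun i hi => by omega⟩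
    · have h1 : r ≠ 12 := by omega
      have h2 : r ≠ 20 := by omega
      simp [runAll, Instr.run, State.set_reg, h1, h2]
    · simp [runAll, Instr.run, State.set_reg, h.r4]
    · simp [runAll, Instr.run, State.set_reg, ha]
    · simp [runAll, Instr.run, State.set_reg, hb]
    · simp [runAll, Instr.run, State.set_reg, h.r6]
    · simp [runAll, Instr.run, State.set_reg, h.r6]
  · rintro st' t ⟨ht, hs, -, -, -, -, hrest⟩
    exact ⟨by simp only [List.length_cons, List.length_nil]; omega, hs, hrest⟩

/-! ### The greedy test of one guess -/

/-- Greedy placement of the pattern elements in the order of their y-coordinates. Register `11` ends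
below `n + 1` if all of them could be placed. -/
def testGuess : Cmd :=
  .seq (.block [.const 11 0, .const 10 0]) <| .loop 10 2 <|
    .seq (.block [.add 10 10 1]) <| .seq findElement <| .seq findStrip <| .seq scanStrip <|
    .block [.copy 11 20]

theorem Reach.le {I : Data} (hI : I.Valid) {d : ℕ → ℕ} {v c : ℕ} (h : Reach I d v c) :
    c ≤ I.n := by
  cases v with
  | zero => rw [show c = 0 from h]; exact Nat.zero_le _
  | succ v =>
    obtain ⟨c', -, i, -, -, q, hq, -, -, -, rfl⟩ := h
    exact hI.V_le q hq

/-- Register `11` holds the least height reachable after `v` elements, or `n + 1` if there is none.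
The minimum suffices because the previous height enters `Reach` only through `c' < I.V q`, which is
easier to satisfy for smaller `c'`. -/
theorem wp_testGuess {I : Data} (hI : I.Valid) {d : ℕ → ℕ} {st : State} (h : Ctx I st)
    (hd : Digits I d st) (hdn : ∀ k, d k ≤ I.n + 1) :
    WP I.space testGuess st fun st' t => t ≤ I.l * (19 * I.l + 16 * I.n + 20) + 4 ∧
      Same I.space 10 st st' ∧ (st'.reg 11 < I.n + 1 ↔ ∃ c, Reach I d I.l c) := by
  have hspace : I.space = 10 * (I.l + I.n) + 20 := rfl
  refine WP.seq (WP.block h.fits (by simp [SafeAll, Instr.Safe]) fun hF => ?_)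
  let Inv : ℕ → State → Prop := fun v st' => Same I.space 10 st st' ∧ v ≤ I.l ∧
    st'.reg 10 = v ∧ (st'.reg 11 = I.n + 1 ∨ Reach I d v (st'.reg 11)) ∧
    st'.reg 11 ≤ I.n + 1 ∧ ∀ c, Reach I d v c → st'.reg 11 ≤ c
  refine (WP.loop (Q := Inv I.l) Inv I.l (19 * I.l + 16 * I.n + 18)
    (fun i st' hi => hi.1.fits) ?_ ?_).mono ?_
  · rintro v st1 ⟨hs, hv, h10, hex, hle, hmin⟩
    have hC := h.of_same hs (by norm_num)
    rcases hv.eq_or_lt with rfl | hlt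
    · left
      rw [hC.r2, h10]
      exact ⟨le_rfl, hs, le_rfl, h10, hex, hle, hmin⟩
    right
    rw [hC.r2, h10]
    refine ⟨hlt, hlt, WP.seq (WP.block hs.fits ?_ fun hF2 => ?_)⟩
    · simp [SafeAll, Instr.Safe, hC.r1, h10]; omega
    have h10' : (runAll [.add 10 10 1] st1).reg 10 = v + 1 := by
      simp [runAll, Instr.run, State.set_reg, hC.r1, h10]
    have h11' : (runAll [.add 10 10 1] st1).reg 11 = st1.reg 11 := by
      simp [runAll, Instr.run, State.set_reg]
    have hs2 : Same I.space 10 st (runAll [.add 10 10 1] st1) := ⟨hF2, hs.mem, fun r hr => by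
      have : r ≠ 10 := by omega
      simpa [runAll, Instr.run, State.set_reg, this] using hs.reg r hr⟩
    generalize runAll [.add 10 10 1] st1 = st2 at hF2 h10' h11' hs2
    refine WP.seq ((wp_findElement hI (h.of_same hs2 (by norm_num))).mono ?_)
    rintro st3 t3 ⟨ht3, hs3, hx⟩
    obtain ⟨i, hi, hiY⟩ := hI.Y_surj v hlt
    have hs3' := hs2.trans hs3 (by norm_num)
    refine WP.seq ((wp_findStrip (h.of_same hs3' (by norm_num)) (hd.of_same hs3') hdn
      (hx i hi (by rw [hiY, h10'])) (hI.X_mem i hi).1 (hI.X_mem i hi).2).mono ?_)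
    rintro st4 t4 ⟨ht4, hs4, hlo, hhi⟩
    have hs4' := hs3'.trans hs4 (by norm_num)
    have h11 : st4.reg 11 = st1.reg 11 := by
      rw [hs4.reg _ (by norm_num), hs3.reg _ (by norm_num), h11']
    refine WP.seq ((wp_scanStrip hI (h.of_same hs4' (by norm_num)) hlo hhi h11).mono ?_)
    rintro st5 t5 ⟨ht5, hs5, hex5, hle5, hmin5⟩
    have hs5' := hs4'.trans hs5 (by norm_num)
    have h10'' : st5.reg 10 = v + 1 := by
      rw [hs5.reg _ (by norm_num), hs4.reg _ (by norm_num), hs3.reg _ (by norm_num), h10']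
    have hr11 : (runAll [.copy 11 20] st5).reg 11 = st5.reg 20 := by
      simp [runAll, Instr.run, State.set_reg]
    refine WP.block hs5.fits (by simp [SafeAll, Instr.Safe]) fun hF6 =>
      ⟨by simp only [List.length_cons, List.length_nil]; omega,
        ⟨hF6, hs5'.mem, fun r hr => ?_⟩, hlt, ?_, ?_, ?_, ?_⟩
    · have : r ≠ 11 := by omega
      simpa [runAll, Instr.run, State.set_reg, this] using hs5'.reg r hr
    · simpa [runAll, Instr.run, State.set_reg] using h10''
    · rw [hr11]
      rcases hex5 with h5 | ⟨q, hq, h1, h2, h3, h4⟩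
      · exact Or.inl h5
      -- A point was found above register `11`, so that register cannot have been `n + 1`: after a
      -- failure the scans find nothing more.
      · refine Or.inr ⟨st1.reg 11, hex.resolve_left fun h' => ?_, i, hi, hiY, q, hq, h1, h2, h3,
          h4⟩
        have := hI.V_le q hq
        omega
    · rw [hr11]; exact hle5
    · rintro c ⟨c', hc', i', hi', hiY', q, hq, h1, h2, h3, rfl⟩
      obtain rfl : i' = i := hI.Y_inj _ hi' _ hi (hiY'.trans hiY.symm)
      rw [hr11]
      exact hmin5 q hq ((hmin c' hc').trans_lt h1) h2 h3
  · refine ⟨⟨hF, rfl, fun r hr => ?_⟩, by omega, ?_, Or.inr ?_, ?_, fun c hc => ?_⟩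
    · have h1 : r ≠ 10 := by omega
      have h2 : r ≠ 11 := by omega
      simp [runAll, Instr.run, State.set_reg, h1, h2]
    · simp [runAll, Instr.run, State.set_reg]
    · simp [runAll, Instr.run, State.set_reg, Reach]
    · simp [runAll, Instr.run, State.set_reg]
    · simp [runAll, Instr.run, State.set_reg]
  · rintro st' t ⟨ht, hs, -, -, hex, hle, hmin⟩
    refine ⟨?_, hs, fun hlt => ⟨_, hex.resolve_left (by omega)⟩, fun ⟨c, hc⟩ => ?_⟩
    · rw [show 19 * I.l + 16 * I.n + 18 + 2 = 19 * I.l + 16 * I.n + 20 from rfl] at ht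
      simp only [List.length_cons, List.length_nil]; omega
    · exact Nat.lt_succ_of_le ((hmin c hc).trans (hc.le hI))

/-! ### Enumerating the guesses -/

/-- The `k`-th guess of x-coordinates: `guess m n k i` is the `i`-th digit of `k` in base `n`, plus
one, for `1 ≤ i ≤ m`, with the sentinels `0` and `n + 1` around. -/
def guess (m n k i : ℕ) : ℕ :=
  if i = 0 then 0 else if i ≤ m then k / n ^ (i - 1) % n + 1 else n + 1

/-- The assumption `m ≤ n` excludes base `n = 0` as soon as there is a digit; reduction modulo 0
would leave the digit unbounded. -/
theorem guess_le {m n : ℕ} (h : m ≤ n) (k i : ℕ) : guess m n k i ≤ n + 1 := by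
  unfold guess
  split_ifs with h0 h1
  · omega
  · have := Nat.mod_lt (k / n ^ (i - 1)) (show n > 0 by omega)
    omega
  · exact le_rfl

/-- Increment the digits; register `21` ends as the carry. -/
def nextGuess : Cmd :=
  .seq (.block [.const 21 1, .add 16 5 1]) <| .loop 16 7 <|
    .seq (.block [.load 22 16, .add 22 22 21]) <|
    .seq (.ite 3 22 (.block [.const 22 1, .const 21 1]) (.block [.const 21 0])) <|
    .block [.store 16 22, .add 16 16 1]

theorem digit_succ {n : ℕ} (k i : ℕ) :
    (k + 1) / n ^ i % n = (k / n ^ i % n + if n ^ i ∣ k + 1 then 1 else 0) % n := by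
  rw [Nat.succ_div, Nat.mod_add_mod]

/-- The law of carries: when `k` is incremented, digit `i` receives a carry exactly if `n ^ i ∣ k +
1`, and passes it on exactly if it also equals `n - 1`. -/
theorem pow_succ_dvd_succ_iff {n : ℕ} (hn : 0 < n) (k i : ℕ) :
    n ^ (i + 1) ∣ k + 1 ↔ n ^ i ∣ k + 1 ∧ k / n ^ i % n + 1 = n := by
  have hlt := Nat.mod_lt (k / n ^ i) hn
  constructor
  · intro h
    have hi : n ^ i ∣ k + 1 := (pow_dvd_pow n (Nat.le_succ i)).trans h
    refine ⟨hi, ?_⟩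
    have h1 : n ∣ (k + 1) / n ^ i := by
      rw [pow_succ] at h
      exact Nat.dvd_div_of_mul_dvd h
    rw [Nat.succ_div_of_dvd hi, Nat.dvd_iff_mod_eq_zero, ← Nat.mod_add_mod] at h1
    by_contra hne
    rw [Nat.mod_eq_of_lt (by omega)] at h1
    omega
  · rintro ⟨hi, he⟩
    have h1 : n ∣ (k + 1) / n ^ i := by
      rw [Nat.succ_div_of_dvd hi, Nat.dvd_iff_mod_eq_zero, ← Nat.mod_add_mod, he, Nat.mod_self]
    rw [pow_succ]
    exact Nat.mul_dvd_of_dvd_div hi h1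

/-- After `c` rounds the lowest `c` digits belong to `k + 1`, the others still to `k`, and register
`21` is the carry into digit `c`. Digits are stored with one added, so overflow means exceeding `n`
and resets the cell to 1. The final carry reports that the counter has wrapped around. -/
theorem wp_nextGuess {I : Data} (hn : 0 < I.n) {k : ℕ} {st : State} (h : Ctx I st)
    (hd : Digits I (guess (I.l / 2) I.n k) st) :
    WP I.space nextGuess st fun st' t => t ≤ 9 * (I.l / 2) + 4 ∧ Ctx I st' ∧
      st'.reg 8 = st.reg 8 ∧ Digits I (guess (I.l / 2) I.n (k + 1)) st' ∧
      st'.reg 21 = if I.n ^ (I.l / 2) ∣ k + 1 then 1 else 0 := by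
  have hspace : I.space = 10 * (I.l + I.n) + 20 := rfl
  have hbase : I.base = 2 + 2 * I.l + 2 * I.n := rfl
  set m := I.l / 2 with hm
  refine WP.seq (WP.block h.fits ?_ fun hF => ?_)
  · simp [SafeAll, Instr.Safe, Instr.run, State.set_reg, h.r5, h.r1]; omega
  let Inv : ℕ → State → Prop := fun c st' => st'.Fits I.space ∧ c ≤ m ∧
    (∀ r < 10, st'.reg r = st.reg r) ∧ st'.reg 16 = I.base + 1 + c ∧
    (st'.reg 21 = if I.n ^ c ∣ k + 1 then 1 else 0) ∧
    ∀ a, st'.mem a = if I.base + 1 ≤ a ∧ a < I.base + 1 + c then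
      guess m I.n (k + 1) (a - I.base) else st.mem a
  refine (WP.loop (Q := Inv m) Inv m 7 (fun i st' hi => hi.1) ?_ ?_).mono ?_
  · rintro c st1 ⟨hF1, hc, hr, h16, h21, hmem⟩
    have h7 : st1.reg 7 = I.base + m + 1 := by rw [hr _ (by norm_num), h.r7]
    have h1 : st1.reg 1 = 1 := by rw [hr _ (by norm_num), h.r1]
    have h3 : st1.reg 3 = I.n := by rw [hr _ (by norm_num), h.r3]
    rcases hc.eq_or_lt with rfl | hlt
    · left
      rw [h7, h16]
      exact ⟨by omega, hF1, le_rfl, hr, h16, h21, hmem⟩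
    right
    rw [h7, h16]
    have hcar : (if I.n ^ c ∣ k + 1 then 1 else 0) ≤ 1 := by split_ifs <;> omega
    have hmod := Nat.mod_lt (k / I.n ^ c) hn
    have hdig : st1.mem (I.base + 1 + c) = k / I.n ^ c % I.n + 1 := by
      rw [hmem, if_neg (by omega), show I.base + 1 + c = I.base + (c + 1) by omega,
        hd (c + 1) (by omega), guess, if_neg (by omega), if_pos (by omega), Nat.add_sub_cancel]
    have hnext : guess m I.n (k + 1) (c + 1) =
        (k / I.n ^ c % I.n + if I.n ^ c ∣ k + 1 then 1 else 0) % I.n + 1 := by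
      rw [guess, if_neg (by omega), if_pos (by omega), Nat.add_sub_cancel, digit_succ]
    refine ⟨by omega, hlt, WP.seq (WP.block hF1 ?_ fun hF2 => ?_)⟩
    · simp [SafeAll, Instr.Safe, Instr.run, State.set_reg, h16, hdig, h21]; omega
    simp only [List.length_cons, List.length_nil]
    -- The two branches, overflow and no overflow, share this ending, which stores the new digit.
    have hend : ∀ (st3 : State) (t : ℕ), st3.Fits I.space → t ≤ 5 →
        (∀ r < 10, st3.reg r = st1.reg r) → st3.reg 16 = st1.reg 16 → st3.mem = st1.mem →
        (st3.reg 21 = if I.n ^ (c + 1) ∣ k + 1 then 1 else 0) →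
        st3.reg 22 = guess m I.n (k + 1) (c + 1) →
        WP I.space (.block [.store 16 22, .add 16 16 1]) st3 fun st' t' =>
          t + t' ≤ 7 ∧ Inv (c + 1) st' := by
      intro st3 t hF3 ht hr3 h163 hm3 h213 h223
      have h13 : st3.reg 1 = 1 := by rw [hr3 _ (by norm_num), h1]
      refine WP.block hF3 ?_ fun hF4 => ⟨by simp only [List.length_cons, List.length_nil]; omega,
        hF4, hlt, fun r hr' => ?_, ?_, ?_, fun a => ?_⟩
      · simp [SafeAll, Instr.Safe, Instr.run, State.write_reg, h163, h16, h13]; omega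
      · have : r ≠ 16 := by omega
        simp [runAll, Instr.run, State.set_reg, State.write_reg, this, hr3 r hr', hr r hr']
      · simp [runAll, Instr.run, State.set_reg, State.write_reg, h163, h16, h13]; omega
      · simpa [runAll, Instr.run, State.set_reg, State.write_reg] using h213
      · simp only [runAll, Instr.run, State.set_mem, State.write_mem, h163, h16, hm3, h223]
        by_cases ha : a = I.base + 1 + c
        · rw [if_pos ha, if_pos (by omega), ha]
          congr 1
          omega
        · rw [if_neg ha, hmem]
          refine if_congr ?_ rfl rfl
          omega
    generalize hst2 : runAll [.load 22 16, .add 22 22 21] st1 = st2 at hF2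
    have h22 : st2.reg 22 = k / I.n ^ c % I.n + 1 + if I.n ^ c ∣ k + 1 then 1 else 0 := by
      simp [← hst2, runAll, Instr.run, State.set_reg, h16, hdig, h21]
    have hr2 : ∀ r, r ≠ 22 → st2.reg r = st1.reg r := fun r hr => by
      simp [← hst2, runAll, Instr.run, State.set_reg, hr]
    have hm2 : st2.mem = st1.mem := by rw [← hst2]; rfl
    refine WP.seq ((WP.ite (Q := fun st' t => t ≤ 3 ∧ st'.Fits I.space ∧
      (∀ r < 10, st'.reg r = st1.reg r) ∧ st'.reg 16 = st1.reg 16 ∧ st'.mem = st1.mem ∧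
      (st'.reg 21 = if I.n ^ (c + 1) ∣ k + 1 then 1 else 0) ∧
      st'.reg 22 = guess m I.n (k + 1) (c + 1)) hF2 (fun _ _ hq => hq.2.1) (fun hlt => ?_)
      fun hge => ?_).mono ?_)
    · rw [hr2 3 (by norm_num), h3, h22] at hlt
      have hdvd : I.n ^ c ∣ k + 1 := by
        by_contra hnd
        rw [if_neg hnd] at hlt
        omega
      rw [if_pos hdvd] at hlt
      have he : k / I.n ^ c % I.n + 1 = I.n := by omega
      refine WP.block hF2 ?_ fun hF3 => ⟨by norm_num, hF3, fun r hr => ?_, ?_, hm2, ?_, ?_⟩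
      · simp [SafeAll, Instr.Safe]; omega
      · have h1 : r ≠ 21 := by omega
        have h2 : r ≠ 22 := by omega
        simp [runAll, Instr.run, State.set_reg, h1, h2, hr2]
      · simp [runAll, Instr.run, State.set_reg, hr2]
      · rw [if_pos ((pow_succ_dvd_succ_iff hn k c).2 ⟨hdvd, he⟩)]
        simp [runAll, Instr.run, State.set_reg]
      · rw [hnext, if_pos hdvd, he, Nat.mod_self]
        simp [runAll, Instr.run, State.set_reg]
    · rw [hr2 3 (by norm_num), h3, h22] at hge
      refine WP.block hF2 ?_ fun hF3 => ⟨by norm_num, hF3, fun r hr => ?_, ?_, hm2, ?_, ?_⟩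
      · simp [SafeAll, Instr.Safe]
      · have h1 : r ≠ 21 := by omega
        have h2 : r ≠ 22 := by omega
        simp [runAll, Instr.run, State.set_reg, h1, h2, hr2]
      · simp [runAll, Instr.run, State.set_reg, hr2]
      · rw [if_neg]
        · simp [runAll, Instr.run, State.set_reg]
        · rw [pow_succ_dvd_succ_iff hn]
          rintro ⟨hdvd, he⟩
          rw [if_pos hdvd] at hge
          omega
      · rw [hnext, Nat.mod_eq_of_lt (by omega)]
        simp [runAll, Instr.run, State.set_reg, h22]
        omega
    · rintro st3 t3 ⟨ht3, hF3, hr3, h163, hm3, h213, h223⟩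
      exact (hend st3 (2 + t3) hF3 (by omega) hr3 h163 hm3 h213 h223).mono fun st' t h' =>
        ⟨by omega, h'.2⟩
  · refine ⟨hF, by omega, fun r hr => ?_, ?_, ?_, fun a => ?_⟩
    · have h1 : r ≠ 16 := by omega
      have h2 : r ≠ 21 := by omega
      simp [runAll, Instr.run, State.set_reg, h1, h2]
    · simp [runAll, Instr.run, State.set_reg, h.r5, h.r1]
    · simp [runAll, Instr.run, State.set_reg]
    · rw [if_neg (by omega)]; rfl
  · rintro st' t ⟨ht, hF', -, hr, -, h21, hmem⟩
    have hlow : ∀ a ≤ I.base, st'.mem a = st.mem a := fun a ha => by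
      rw [hmem, if_neg (by omega)]
    refine ⟨by simp only [List.length_cons, List.length_nil]; omega, ?_, hr _ (by norm_num),
      fun i hi => ?_, h21⟩
    · exact
      { fits := hF'
        r0 := by rw [hr _ (by omega), h.r0]
        r1 := by rw [hr _ (by omega), h.r1]
        r2 := by rw [hr _ (by omega), h.r2]
        r3 := by rw [hr _ (by omega), h.r3]
        r4 := by rw [hr _ (by omega), h.r4]
        r5 := by rw [hr _ (by omega), h.r5]
        r6 := by rw [hr _ (by omega), h.r6]
        r7 := by rw [hr _ (by omega), h.r7]
        mX := fun i hi => by rw [hlow _ (by omega), h.mX i hi]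
        mY := fun i hi => by rw [hlow _ (by omega), h.mY i hi]
        mU := fun i hi => by rw [hlow _ (by omega), h.mU i hi]
        mV := fun i hi => by rw [hlow _ (by omega), h.mV i hi] }
    · rw [hmem]
      by_cases hi' : I.base + 1 ≤ I.base + i ∧ I.base + i < I.base + 1 + m
      · rw [if_pos hi', Nat.add_sub_cancel_left]
      -- The remaining cells are the two sentinels, which do not depend on `k`.
      · rw [if_neg hi', hd i hi]
        unfold guess
        split_ifs <;> omega

/-- Some guess can be completed. -/
def Success (I : Data) : Prop :=
  ∃ k < I.n ^ (I.l / 2), ∃ c, Reach I (guess (I.l / 2) I.n k) I.l c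

/-- Try all guesses; register `8` ends positive if one of them can be completed. -/
def tryAll : Cmd :=
  .loop 0 9 <| .seq testGuess <| .ite 11 6 (.block [.const 8 1, .const 9 0]) <|
    .seq nextGuess <| .block [.sub 9 1 21]

/-- A bound for the time spent on one guess. -/
def Data.roundTime (I : Data) : ℕ := I.l * (19 * I.l + 16 * I.n + 20) + 9 * (I.l / 2) + 11

/-- Register `9` is 1 as long as the search goes on. In that case all earlier guesses have failed;
once it is 0, only the correctness of register `8` is recorded. -/
theorem wp_tryAll {I : Data} (hI : I.Valid) (hl : I.l ≤ I.n) {st : State} (h : Ctx I st)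
    (h8 : st.reg 8 = 0) (h9 : st.reg 9 = 1) (hd : Digits I (guess (I.l / 2) I.n 0) st) :
    WP I.space tryAll st fun st' t => t ≤ I.n ^ (I.l / 2) * (I.roundTime + 2) + 2 ∧
      st'.Fits I.space ∧ st'.reg 0 = 0 ∧ (0 < st'.reg 8 ↔ Success I) := by
  have hround : I.roundTime = I.l * (19 * I.l + 16 * I.n + 20) + 9 * (I.l / 2) + 11 := rfl
  have hspace : I.space = 10 * (I.l + I.n) + 20 := rfl
  let Inv : ℕ → State → Prop := fun k st' => st'.Fits I.space ∧ st'.reg 0 = 0 ∧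
    ((st'.reg 9 = 0 ∧ (0 < st'.reg 8 ↔ Success I)) ∨
      (st'.reg 9 = 1 ∧ st'.reg 8 = 0 ∧ Ctx I st' ∧ Digits I (guess (I.l / 2) I.n k) st' ∧
        k < I.n ^ (I.l / 2) ∧ ∀ k' < k, ¬ ∃ c, Reach I (guess (I.l / 2) I.n k') I.l c))
  refine WP.loop Inv _ _ (fun _ _ hi => hi.1) ?_
    ⟨h.fits, h.r0, Or.inr ⟨h9, h8, h, hd, ?_, fun k' hk' => absurd hk' (Nat.not_lt_zero _)⟩⟩
  swap
  · rcases Nat.eq_zero_or_pos I.n with h0 | hpos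
    -- For an empty text the pattern is empty too, and there is exactly one guess, the empty one.
    · rw [show I.l / 2 = 0 by omega, pow_zero]; exact Nat.one_pos
    · exact pow_pos hpos _
  rintro k st1 ⟨hF1, h0, hdone | ⟨h9, h8, hC, hd, hk, hprev⟩⟩
  · exact Or.inl ⟨by rw [h0, hdone.1], hF1, h0, hdone.2⟩
  right
  rw [h0, h9]
  refine ⟨Nat.one_pos, hk, WP.seq ((wp_testGuess hI hC hd (guess_le (by omega) k)).mono ?_)⟩
  rintro st2 t2 ⟨ht2, hs2, hiff⟩
  have hC2 := hC.of_same hs2 (by norm_num)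
  have hd2 := hd.of_same hs2
  refine WP.ite hs2.fits (fun st' t hq => hq.2.1) (fun hlt => ?_) fun hge => ?_
  · rw [hC2.r6, hiff] at hlt
    refine WP.block hs2.fits ?_ fun hF3 => ⟨by simp only [List.length_cons, List.length_nil]; omega,
      hF3, ?_, Or.inl ⟨?_, ?_⟩⟩
    · simp [SafeAll, Instr.Safe]; omega
    · simp [runAll, Instr.run, State.set_reg, hC2.r0]
    · simp [runAll, Instr.run, State.set_reg]
    · have hS : Success I := ⟨k, hk, hlt⟩
      simp [runAll, Instr.run, State.set_reg, hS]
  · rw [hC2.r6] at hge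
    have hfail : ¬ ∃ c, Reach I (guess (I.l / 2) I.n k) I.l c := fun hh => by
      have := hiff.2 hh
      omega
    -- An empty pattern is always completed, so a failed guess forces a nonempty text.
    have hn : 0 < I.n := by
      by_contra hn
      obtain hl0 : I.l = 0 := by omega
      refine hfail ⟨0, ?_⟩
      rw [hl0]
      rfl
    refine WP.seq ((wp_nextGuess hn hC2 hd2).mono ?_)
    rintro st3 t3 ⟨ht3, hC3, h83, hd3, h21⟩
    have hpre : ∀ k' < k + 1, ¬ ∃ c, Reach I (guess (I.l / 2) I.n k') I.l c := fun k' hk' => by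
      rcases Nat.lt_succ_iff_lt_or_eq.mp hk' with hk' | rfl
      · exact hprev k' hk'
      · exact hfail
    refine WP.block hC3.fits (by simp [SafeAll, Instr.Safe]) fun hF4 =>
      ⟨by simp only [List.length_cons, List.length_nil]; omega, hF4, ?_, ?_⟩
    · simp [runAll, Instr.run, State.set_reg, hC3.r0]
    have hr8 : (runAll [.sub 9 1 21] st3).reg 8 = 0 := by
      simp [runAll, Instr.run, State.set_reg, h83, hs2.reg, h8]
    have hr9 : (runAll [.sub 9 1 21] st3).reg 9 = 1 - st3.reg 21 := by
      simp [runAll, Instr.run, State.set_reg, hC3.r1]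
    by_cases hdvd : I.n ^ (I.l / 2) ∣ k + 1
    · rw [if_pos hdvd] at h21
      refine Or.inl ⟨by rw [hr9, h21], ?_⟩
      rw [hr8]
      refine iff_of_false (lt_irrefl _) ?_
      -- The carry out of the top digit means `n ^ (l / 2) ≤ k + 1`, so every guess has been
      -- refuted.
      rintro ⟨k', hk', hS⟩
      have := Nat.le_of_dvd (Nat.succ_pos _) hdvd
      exact hpre k' (by omega) hS
    · rw [if_neg hdvd] at h21
      refine Or.inr ⟨by rw [hr9, h21], hr8, ?_, ?_, ?_, hpre⟩
      · refine hC3.of_same (K := 9) ⟨hF4, rfl, fun r hr => ?_⟩ (by norm_num)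
        have : r ≠ 9 := by omega
        simp [runAll, Instr.run, State.set_reg, this]
      · exact hd3
      · refine lt_of_le_of_ne hk fun he => hdvd ?_
        rw [← he]

/-! ### Initialisation and the whole search -/

/-- Set up the constants and the digits. -/
def setUp : Cmd :=
  .seq (.block [.const 22 2, .add 4 22 2, .add 4 4 2, .add 5 4 3, .add 5 5 3, .add 6 3 1,
    .add 7 5 1, .copy 17 1]) <|
  .seq (.loop 17 2 (.block [.store 7 1, .add 7 7 1, .add 17 17 1, .add 17 17 1])) <|
  .block [.store 7 6, .const 9 1]

/-- The whole search. -/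
def search : Cmd :=
  .seq (.block [.const 1 1, .load 2 0, .load 3 1]) <|
    .ite 3 2 (.block []) (.seq setUp tryAll)

/-- The memory holds the input and nothing else. -/
structure Input (I : Data) (mem : ℕ → ℕ) : Prop where
  m0 : mem 0 = I.l
  m1 : mem 1 = I.n
  mX : ∀ i < I.l, mem (2 + 2 * i) = I.X i
  mY : ∀ i < I.l, mem (2 + 2 * i + 1) = I.Y i
  mU : ∀ q < I.n, mem (2 + 2 * I.l + 2 * q) = I.U q
  mV : ∀ q < I.n, mem (2 + 2 * I.l + 2 * q + 1) = I.V q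
  le : ∀ a, mem a ≤ I.space
  zero : ∀ a, I.base ≤ a → mem a = 0

theorem wp_setUp {I : Data} {st : State} (hin : Input I st.mem) (hF : st.Fits I.space)
    (h0 : st.reg 0 = 0) (h1 : st.reg 1 = 1) (h2 : st.reg 2 = I.l) (h3 : st.reg 3 = I.n)
    (h8 : st.reg 8 = 0) :
    WP I.space setUp st fun st' t => t ≤ 6 * (I.l / 2) + 12 ∧ Ctx I st' ∧ st'.reg 8 = 0 ∧
      st'.reg 9 = 1 ∧ Digits I (guess (I.l / 2) I.n 0) st' := by
  have hspace : I.space = 10 * (I.l + I.n) + 20 := rfl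
  have hbase : I.base = 2 + 2 * I.l + 2 * I.n := rfl
  refine WP.seq (WP.block hF ?_ fun hF1 => ?_)
  · simp [SafeAll, Instr.Safe, Instr.run, State.set_reg, h1, h2, h3]; omega
  set st1 := runAll [.const 22 2, .add 4 22 2, .add 4 4 2, .add 5 4 3, .add 5 5 3, .add 6 3 1,
    .add 7 5 1, .copy 17 1] st with hst1
  let Inv : ℕ → State → Prop := fun c st' => st'.Fits I.space ∧ c ≤ I.l / 2 ∧
    (∀ r, r ≠ 7 → r ≠ 17 → st'.reg r = st1.reg r) ∧ st'.reg 7 = I.base + 1 + c ∧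
    st'.reg 17 = 1 + 2 * c ∧
    ∀ a, st'.mem a = if I.base + 1 ≤ a ∧ a < I.base + 1 + c then 1 else st.mem a
  have hr1 : st1.reg 0 = 0 ∧ st1.reg 1 = 1 ∧ st1.reg 2 = I.l ∧ st1.reg 3 = I.n ∧
      st1.reg 4 = 2 + 2 * I.l ∧ st1.reg 5 = I.base ∧ st1.reg 6 = I.n + 1 ∧
      st1.reg 7 = I.base + 1 ∧ st1.reg 17 = 1 ∧ st1.reg 8 = 0 := by
    simp [hst1, runAll, Instr.run, State.set_reg, h0, h1, h2, h3, h8, hbase]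
    omega
  obtain ⟨g0, g1, g2, g3, g4, g5, g6, g7, g17, g8⟩ := hr1
  refine WP.seq ((WP.loop (Q := Inv (I.l / 2)) Inv (I.l / 2) 4 (fun _ _ hi => hi.1) ?_ ?_).mono ?_)
  · rintro c st2 ⟨hF2, hc, hr, h7, h17, hmem⟩
    have k2 : st2.reg 2 = I.l := by rw [hr _ (by norm_num) (by norm_num), g2]
    have k1 : st2.reg 1 = 1 := by rw [hr _ (by norm_num) (by norm_num), g1]
    rw [h17, k2]
    rcases le_or_gt I.l (1 + 2 * c) with hle | hlt
    -- The counter 1, 3, 5, … reaches `l` after exactly `l / 2` rounds, one per digit.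
    · obtain rfl : c = I.l / 2 := by omega
      exact Or.inl ⟨hle, hF2, le_rfl, hr, h7, h17, hmem⟩
    refine Or.inr ⟨hlt, by omega, WP.block hF2 ?_ fun hF3 => ⟨by simp, hF3, by omega,
      fun r hr7 hr17 => ?_, ?_, ?_, fun a => ?_⟩⟩
    · simp [SafeAll, Instr.Safe, Instr.run, State.set_reg, State.write_reg, h7, k1, h17]; omega
    · simp [runAll, Instr.run, State.set_reg, State.write_reg, hr7, hr17, hr]
    · simp [runAll, Instr.run, State.set_reg, State.write_reg, h7, k1]; omega
    · simp [runAll, Instr.run, State.set_reg, State.write_reg, h17, k1]; omega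
    · simp only [runAll, Instr.run, State.set_mem, State.write_mem, h7, k1, hmem]
      split_ifs <;> omega
  · refine ⟨hF1, by omega, fun _ _ _ => rfl, g7, g17, fun a => ?_⟩
    rw [if_neg (by omega)]
    rfl
  rintro st2 t ⟨ht, hF2, -, hr, h7, h17, hmem⟩
  refine WP.block hF2 ?_ fun hF3 => ?_
  · simp [SafeAll, Instr.Safe, h7]; omega
  have hreg : ∀ r < 9, (runAll [.store 7 6, .const 9 1] st2).reg r = st2.reg r := fun r hr' => by
    have : r ≠ 9 := by omega
    simp [runAll, Instr.run, State.set_reg, State.write_reg, this]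
  have hmem3 : ∀ a, (runAll [.store 7 6, .const 9 1] st2).mem a =
      if a = I.base + 1 + I.l / 2 then I.n + 1 else st2.mem a := fun a => by
    simp [runAll, Instr.run, State.set_mem, State.write_mem, h7, hr, g6]
  have hlow : ∀ a ≤ I.base, (runAll [.store 7 6, .const 9 1] st2).mem a = st.mem a :=
    fun a ha => by rw [hmem3, if_neg (by omega), hmem, if_neg (by omega)]
  refine ⟨by simp only [List.length_cons, List.length_nil]; omega, ?_, ?_, ?_, fun i hi => ?_⟩
  · exact
    { fits := hF3
      r0 := by rw [hreg _ (by omega), hr _ (by omega) (by omega), g0]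
      r1 := by rw [hreg _ (by omega), hr _ (by omega) (by omega), g1]
      r2 := by rw [hreg _ (by omega), hr _ (by omega) (by omega), g2]
      r3 := by rw [hreg _ (by omega), hr _ (by omega) (by omega), g3]
      r4 := by rw [hreg _ (by omega), hr _ (by omega) (by omega), g4]
      r5 := by rw [hreg _ (by omega), hr _ (by omega) (by omega), g5]
      r6 := by rw [hreg _ (by omega), hr _ (by omega) (by omega), g6]
      r7 := by rw [hreg _ (by omega), h7]; omega
      mX := fun i hi => by rw [hlow _ (by omega), hin.mX i hi]
      mY := fun i hi => by rw [hlow _ (by omega), hin.mY i hi]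
      mU := fun i hi => by rw [hlow _ (by omega), hin.mU i hi]
      mV := fun i hi => by rw [hlow _ (by omega), hin.mV i hi] }
  · rw [hreg _ (by omega), hr _ (by omega) (by omega), g8]
  · simp [runAll, Instr.run, State.set_reg]
  · unfold guess
    rcases Nat.eq_zero_or_pos i with rfl | hpos
    -- The left sentinel 0 is never written: it is the first free cell, zero from the start.
    · rw [if_pos rfl, hlow _ (by omega), hin.zero _ (by omega)]
    rw [if_neg (by omega), hmem3]
    by_cases him : i ≤ I.l / 2
    · rw [if_pos him, if_neg (by omega), hmem, if_pos (by omega), Nat.zero_div, Nat.zero_mod]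
    · rw [if_neg him, if_pos (by omega)]

/-- Rejecting patterns longer than the text at the outset lets the factors polynomial in `l` be
absorbed into powers of `n`. -/
theorem wp_search {I : Data} (hI : I.Valid) {mem : ℕ → ℕ} (hin : Input I mem) :
    WP I.space search ⟨fun _ => 0, mem⟩ fun st t => st.Fits I.space ∧ st.reg 0 = 0 ∧
      (0 < st.reg 8 ↔ I.l ≤ I.n ∧ Success I) ∧
      (I.n < I.l → t ≤ 4) ∧
      (I.l ≤ I.n → t ≤ I.n ^ (I.l / 2) * (I.roundTime + 2) + 6 * (I.l / 2) + 19) := by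
  have hspace : I.space = 10 * (I.l + I.n) + 20 := rfl
  have hbase : I.base = 2 + 2 * I.l + 2 * I.n := rfl
  have hF : (⟨fun _ => 0, mem⟩ : State).Fits I.space :=
    ⟨fun _ => Nat.zero_le _, hin.le, fun a ha => hin.zero a (by omega)⟩
  refine WP.seq (WP.block hF ?_ fun hF1 => ?_)
  · simp [SafeAll, Instr.Safe]; omega
  have hr1 : (runAll [.const 1 1, .load 2 0, .load 3 1] ⟨fun _ => 0, mem⟩).reg 0 = 0 ∧
      (runAll [.const 1 1, .load 2 0, .load 3 1] ⟨fun _ => 0, mem⟩).reg 1 = 1 ∧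
      (runAll [.const 1 1, .load 2 0, .load 3 1] ⟨fun _ => 0, mem⟩).reg 2 = I.l ∧
      (runAll [.const 1 1, .load 2 0, .load 3 1] ⟨fun _ => 0, mem⟩).reg 3 = I.n ∧
      (runAll [.const 1 1, .load 2 0, .load 3 1] ⟨fun _ => 0, mem⟩).reg 8 = 0 := by
    simp [runAll, Instr.run, State.set_reg, State.set_mem, hin.m0, hin.m1]
  have hm1 : (runAll [.const 1 1, .load 2 0, .load 3 1] ⟨fun _ => 0, mem⟩).mem = mem := rfl
  generalize runAll [.const 1 1, .load 2 0, .load 3 1] ⟨fun _ => 0, mem⟩ = st1 at hF1 hr1 hm1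
  obtain ⟨h0, h1, h2, h3, h8⟩ := hr1
  simp only [List.length_cons, List.length_nil]
  refine WP.ite hF1 (fun st' t hq => hq.1) (fun hlt => ?_) fun hge => ?_
  · rw [h3, h2] at hlt
    refine wp_skip hF1 ⟨hF1, h0, ?_, by omega, by omega⟩
    rw [h8]
    exact iff_of_false (lt_irrefl _) (by omega)
  · rw [h3, h2] at hge
    refine WP.seq ((wp_setUp (hm1.symm ▸ hin) hF1 h0 h1 h2 h3 h8).mono ?_)
    rintro st2 t2 ⟨ht2, hC, g8, g9, hd⟩
    refine (wp_tryAll hI hge hC g8 g9 hd).mono ?_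
    rintro st3 t3 ⟨ht3, hF3, k0, k8⟩
    exact ⟨hF3, k0, by rw [k8]; tauto, by omega, by omega⟩

/-! ### Completable guesses correspond to embeddings -/

/-- The points of two permutations, both numbered from `0` and in general position with coordinates
from `1` to the length. -/
structure Data.Perms (I : Data) : Prop extends I.Valid where
  Y_mem : ∀ i < I.l, 1 ≤ I.Y i ∧ I.Y i ≤ I.l
  X_inj : ∀ i < I.l, ∀ i' < I.l, I.X i = I.X i' → i = i'
  X_surj : ∀ v < I.l, ∃ i < I.l, I.X i = v + 1
  U_mem : ∀ q < I.n, 1 ≤ I.U q ∧ I.U q ≤ I.n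
  V_pos : ∀ q < I.n, 1 ≤ I.V q

/-- `φ` maps the pattern to the text and preserves the strict orders. -/
structure Data.StrictEmbedding (I : Data) (φ : ℕ → ℕ) : Prop where
  lt : ∀ i < I.l, φ i < I.n
  U_lt : ∀ i < I.l, ∀ i' < I.l, I.X i < I.X i' → I.U (φ i) < I.U (φ i')
  V_lt : ∀ i < I.l, ∀ i' < I.l, I.Y i < I.Y i' → I.V (φ i) < I.V (φ i')

theorem Data.StrictEmbedding.length_le {I : Data} (hI : I.Perms) {φ : ℕ → ℕ}
    (h : I.StrictEmbedding φ) : I.l ≤ I.n := by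
  have hinj : Set.InjOn φ (Finset.range I.l) := fun i hi i' hi' he => by
    rw [Finset.mem_coe, Finset.mem_range] at hi hi'
    rcases lt_trichotomy (I.X i) (I.X i') with hlt | heq | hlt
    · exact absurd (he ▸ h.U_lt i hi i' hi' hlt) (lt_irrefl _)
    · exact hI.X_inj i hi i' hi' heq
    · exact absurd (he ▸ h.U_lt i' hi' i hi hlt) (lt_irrefl _)
  have := Finset.card_le_card_of_injOn φ (t := Finset.range I.n)
    (fun i hi => by simpa using h.lt i (by simpa using hi)) hinj
  simpa using this

/-- Base-`n` expansion is a bijection between numbers below `n ^ m` and sequences of `m` digits,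
here shifted by one. -/
theorem exists_guess {m n : ℕ} (f : ℕ → ℕ) (hf : ∀ i, 1 ≤ i → i ≤ m → 1 ≤ f i ∧ f i ≤ n) :
    ∃ k < n ^ m, ∀ i, 1 ≤ i → i ≤ m → guess m n k i = f i := by
  let g : Fin m → Fin n := fun i => ⟨f (i + 1) - 1, by
    have := hf (i + 1) (by omega) (by omega)
    omega⟩
  refine ⟨finFunctionFinEquiv g, (finFunctionFinEquiv g).2, fun i hi him => ?_⟩
  have h := finFunctionFinEquiv_symm_apply_val (finFunctionFinEquiv g) ⟨i - 1, by omega⟩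
  rw [Equiv.symm_apply_apply] at h
  have := hf i hi him
  rw [guess, if_neg (by omega), if_pos him, ← h]
  simp only [g]
  rw [Nat.sub_add_cancel hi]
  omega

/-- The right guess consists of the true x-coordinates of the images of the even elements. Every
image then lies in its strip, since the embedding preserves the horizontal order of neighbours. -/
theorem Data.StrictEmbedding.success {I : Data} (hI : I.Perms) {φ : ℕ → ℕ}
    (h : I.StrictEmbedding φ) : Success I := by
  have hU := fun i hi => hI.U_mem (φ i) (h.lt i hi)
  have hex : ∀ k, 1 ≤ k → k ≤ I.l / 2 → ∃ i < I.l, I.X i = 2 * k := fun k hk hkl => by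
    obtain ⟨i, hi, he⟩ := hI.X_surj (2 * k - 1) (by omega)
    exact ⟨i, hi, by omega⟩
  choose! e hel heX using hex
  obtain ⟨k, hk, hg⟩ := exists_guess (fun k => I.U (φ (e k)))
    (fun k hk hkl => hU _ (hel k hk hkl))
  have hd : ∀ i < I.l, ∀ a, I.X i = 2 * a → guess (I.l / 2) I.n k a = I.U (φ i) := by
    intro i hi a ha
    have := hI.X_mem i hi
    have ha1 : 1 ≤ a := by omega
    have ha2 : a ≤ I.l / 2 := by omega
    rw [hg a ha1 ha2, hI.X_inj i hi (e a) (hel a ha1 ha2) (by rw [ha, heX a ha1 ha2])]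
  have hstrip : ∀ i < I.l, lo (guess (I.l / 2) I.n k) (I.X i) < I.U (φ i) ∧
      I.U (φ i) < hi (guess (I.l / 2) I.n k) (I.X i) := by
    intro i hi
    have hX := hI.X_mem i hi
    have hUi := hU i hi
    unfold lo PatternSearch.hi
    by_cases hpar : I.X i % 2 = 0
    · rw [if_pos hpar, if_pos hpar, hd i hi (I.X i / 2) (by omega)]
      omega
    · rw [if_neg hpar, if_neg hpar]
      constructor
      -- The leftmost element has no left neighbour; the sentinel 0 lies below all columns.
      · rcases Nat.eq_zero_or_pos (I.X i / 2) with h0 | hpos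
        · rw [h0, guess, if_pos rfl]
          omega
        · obtain ⟨i', hi', he⟩ := hI.X_surj (I.X i - 2) (by omega)
          rw [hd i' hi' (I.X i / 2) (by omega)]
          exact h.U_lt i' hi' i hi (by omega)
      -- If the rightmost element has odd x-coordinate, its strip ends at the sentinel `n + 1`.
      · rcases hX.2.eq_or_lt with heq | hlt
        · rw [guess, if_neg (by omega), if_neg (by omega)]
          omega
        · obtain ⟨i', hi', he⟩ := hI.X_surj (I.X i) hlt
          rw [hd i' hi' (I.X i / 2 + 1) (by omega)]
          exact h.U_lt i hi i' hi' (by omega)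
  refine ⟨k, hk, ?_⟩
  -- Strengthened for the induction: the height reached stays below the images of all elements not
  -- yet placed.
  suffices H : ∀ v ≤ I.l, ∃ c, Reach I (guess (I.l / 2) I.n k) v c ∧
      ∀ i < I.l, v < I.Y i → c < I.V (φ i) from (H I.l le_rfl).imp fun _ hc => hc.1
  intro v
  induction v with
  | zero => exact fun _ => ⟨0, rfl, fun i hi _ => hI.V_pos _ (h.lt i hi)⟩
  | succ v ih =>
    intro hv
    obtain ⟨c, hc, hlt⟩ := ih (by omega)
    obtain ⟨i, hi, he⟩ := hI.Y_surj v hv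
    exact ⟨_, ⟨c, hc, i, hi, he, φ i, h.lt i hi, hlt i hi (by omega), (hstrip i hi).1,
      (hstrip i hi).2, rfl⟩, fun i' hi' hlt' => h.V_lt i hi i' hi' (by omega)⟩

/-- Unfold `Reach` one element at a time. The bound `I.V (φ i) ≤ c` is carried along because it puts
each new point above all earlier ones. -/
theorem Reach.exists_placement {I : Data} (hI : I.Perms) {d : ℕ → ℕ} {v c : ℕ}
    (h : Reach I d v c) : ∃ φ : ℕ → ℕ,
      (∀ i < I.l, I.Y i ≤ v → φ i < I.n ∧ I.V (φ i) ≤ c ∧ lo d (I.X i) < I.U (φ i) ∧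
        I.U (φ i) < hi d (I.X i)) ∧
      ∀ i < I.l, ∀ i' < I.l, I.Y i < I.Y i' → I.Y i' ≤ v → I.V (φ i) < I.V (φ i') := by
  induction v generalizing c with
  | zero =>
    have hpos : ∀ i < I.l, I.Y i ≠ 0 := fun i hi => Nat.one_le_iff_ne_zero.1 (hI.Y_mem i hi).1
    exact ⟨id, fun i hi h0 => absurd (Nat.le_zero.1 h0) (hpos i hi),
      fun i hi i' hi' _ h0 => absurd (Nat.le_zero.1 h0) (hpos i' hi')⟩
  | succ v ih =>
    obtain ⟨c', hc', i, hi, hiY, q, hq, h1, h2, h3, rfl⟩ := h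
    obtain ⟨φ, hφ, hlt⟩ := ih hc'
    have hne : ∀ a < I.l, a ≠ i → I.Y a ≤ v + 1 → I.Y a ≤ v := fun a ha hai hY => by
      by_contra hcon
      exact hai (hI.Y_inj a ha i hi (by omega))
    refine ⟨Function.update φ i q, fun a ha hY => ?_, fun a ha b hb hab hY => ?_⟩
    · by_cases hai : a = i
      · subst hai
        rw [Function.update_self]
        exact ⟨hq, le_rfl, h2, h3⟩
      · rw [Function.update_of_ne hai]
        obtain ⟨k1, k2, k3⟩ := hφ a ha (hne a ha hai hY)
        exact ⟨k1, by omega, k3⟩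
    · have hai : a ≠ i := by
        rintro rfl
        omega
      rw [Function.update_of_ne hai]
      by_cases hbi : b = i
      · subst hbi
        rw [Function.update_self]
        have := (hφ a ha (by omega)).2.1
        omega
      · rw [Function.update_of_ne hbi]
        exact hlt a ha b hb hab (hne b hb hbi hY)

/-- The vertical order comes from the placement. Of two consecutive x-coordinates one is even, say
2k, and its point lies in column `d k`, which bounds the strip of the other from the correct side;
chaining neighbours gives the full horizontal order. -/
theorem Success.exists_strictEmbedding {I : Data} (hI : I.Perms) (h : Success I) : ∃ φ, I.StrictEmbedding φ := by
  obtain ⟨k, -, c, hc⟩ := h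
  obtain ⟨φ, hφ, hlt⟩ := hc.exists_placement hI
  have hY := fun i hi => (hI.Y_mem i hi).2
  refine ⟨φ, fun i hi => (hφ i hi (hY i hi)).1, ?_,
    fun i hi i' hi' h => hlt i hi i' hi' h (hY i' hi')⟩
  have hadj : ∀ i < I.l, ∀ i' < I.l, I.X i' = I.X i + 1 → I.U (φ i) < I.U (φ i') := by
    intro i hi i' hi' he
    obtain ⟨-, -, h1, h2⟩ := hφ i hi (hY i hi)
    obtain ⟨-, -, h3, h4⟩ := hφ i' hi' (hY i' hi')
    unfold lo at h1 h3
    unfold PatternSearch.hi at h2 h4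
    by_cases hpar : I.X i % 2 = 0
    · rw [if_pos hpar] at h1 h2
      rw [if_neg (by omega), show I.X i' / 2 = I.X i / 2 by omega] at h3
      omega
    · rw [if_neg hpar] at h1 h2
      rw [if_pos (by omega), show I.X i' / 2 = I.X i / 2 + 1 by omega] at h3
      omega
  suffices H : ∀ t, ∀ i < I.l, ∀ i' < I.l, I.X i' = I.X i + t + 1 → I.U (φ i) < I.U (φ i') from
    fun i hi i' hi' h => H (I.X i' - I.X i - 1) i hi i' hi' (by omega)
  intro t
  induction t with
  | zero => exact hadj
  | succ t ih =>
    intro i hi i' hi' he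
    have := hI.X_mem i' hi'
    obtain ⟨j, hj, hje⟩ := hI.X_surj (I.X i + t) (by omega)
    exact (ih i hi j hj (by omega)).trans (hadj j hj i' hi' (by omega))

/-! ### From permutations to the data of the search -/

/-- The numbers in an instance of Permutation Pattern. -/
def dataOf (σ π : PointPerm) : Data where
  l := σ.length
  n := π.length
  X i := (σ.P (i + 1)).1
  Y i := (σ.P (i + 1)).2
  U q := (π.P (q + 1)).1
  V q := (π.P (q + 1)).2

theorem exists_eq_succ_of_injOn {n : ℕ} {f : ℕ → ℕ} (hf : ∀ i < n, 1 ≤ f i ∧ f i ≤ n)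
    (hinj : ∀ i < n, ∀ j < n, f i = f j → i = j) {v : ℕ} (hv : v < n) : ∃ i < n, f i = v + 1 := by
  have hsurj := Finset.surjOn_of_injOn_of_card_le f
    (s := Finset.range n) (t := Finset.Icc 1 n)
    (fun a ha => by simpa using hf a (by simpa using ha))
    (fun a ha b hb he => hinj a (by simpa using ha) b (by simpa using hb) he) (by simp)
  obtain ⟨a, ha, he⟩ := hsurj (show v + 1 ∈ (Finset.Icc 1 n : Set ℕ) by simp; omega)
  exact ⟨a, by simpa using ha, he⟩

theorem mem_S_of_lt {π : PointPerm} (h : π.IsReduced) {i : ℕ} (hi : i < π.length) :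
    i + 1 ∈ π.S := by
  rw [h.1, Finset.mem_Icc]; omega

theorem bounds_of_mem_S {π : PointPerm} (h : π.IsReduced) {p : ℕ} (hp : p ∈ π.S) :
    1 ≤ p ∧ p ≤ π.length := by
  rwa [h.1, Finset.mem_Icc] at hp

theorem coord_mem {π : PointPerm} (h : π.IsReduced) {i : ℕ} (hi : i < π.length) :
    (1 ≤ (π.P (i + 1)).1 ∧ (π.P (i + 1)).1 ≤ π.length) ∧
      1 ≤ (π.P (i + 1)).2 ∧ (π.P (i + 1)).2 ≤ π.length := by
  simpa using h.2 _ (mem_S_of_lt h hi)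

theorem fst_inj {π : PointPerm} (h : π.IsReduced) : ∀ i < π.length, ∀ j < π.length,
    (π.P (i + 1)).1 = (π.P (j + 1)).1 → i = j := fun _ hi _ hj he =>
  Nat.succ_injective (π.injOn_fst _ (mem_S_of_lt h hi) _ (mem_S_of_lt h hj) he)

theorem snd_inj {π : PointPerm} (h : π.IsReduced) : ∀ i < π.length, ∀ j < π.length,
    (π.P (i + 1)).2 = (π.P (j + 1)).2 → i = j := fun _ hi _ hj he =>
  Nat.succ_injective (π.injOn_snd _ (mem_S_of_lt h hi) _ (mem_S_of_lt h hj) he)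

theorem perms_dataOf {σ π : PointPerm} (hσ : σ.IsReduced) (hπ : π.IsReduced) :
    (dataOf σ π).Perms where
  X_mem _ hi := (coord_mem hσ hi).1
  Y_inj := snd_inj hσ
  Y_surj _ hv := exists_eq_succ_of_injOn (fun _ hi => (coord_mem hσ hi).2) (snd_inj hσ) hv
  V_le _ hq := (coord_mem hπ hq).2.2
  Y_mem _ hi := (coord_mem hσ hi).2
  X_inj := fst_inj hσ
  X_surj _ hv := exists_eq_succ_of_injOn (fun _ hi => (coord_mem hσ hi).1) (fst_inj hσ) hv
  U_mem _ hq := (coord_mem hπ hq).1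
  V_pos _ hq := (coord_mem hπ hq).2.1

/-- Preserving the strict orders already implies reflecting them, because distinct elements of `σ`
have distinct coordinates. The index shift reflects that labels start at 1 and array positions at 0.
-/
theorem isSubpattern_iff {σ π : PointPerm} (hσ : σ.IsReduced) (hπ : π.IsReduced) :
    σ.IsSubpattern π ↔ ∃ φ, (dataOf σ π).StrictEmbedding φ := by
  constructor
  · rintro ⟨φ, hφ⟩
    have hmem : ∀ q : π.S, 1 ≤ (q : ℕ) ∧ (q : ℕ) ≤ π.length := fun q => bounds_of_mem_S hπ q.2
    let ψ : ℕ → ℕ := fun i =>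
      if hi : i < σ.length then (φ ⟨i + 1, mem_S_of_lt hσ hi⟩ : ℕ) - 1 else 0
    have hψ : ∀ i (hi : i < σ.length), ψ i + 1 = φ ⟨i + 1, mem_S_of_lt hσ hi⟩ := fun i hi => by
      have := hmem (φ ⟨i + 1, mem_S_of_lt hσ hi⟩)
      simp only [ψ, dif_pos hi]
      omega
    refine ⟨ψ, fun i hi => ?_, fun i hi j hj hlt => ?_, fun i hi j hj hlt => ?_⟩
    · have := hmem (φ ⟨i + 1, mem_S_of_lt hσ hi⟩)
      rw [← hψ i hi] at this
      exact this.2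
    · simp only [dataOf]
      rw [hψ i hi, hψ j hj]
      exact (hφ ⟨i + 1, mem_S_of_lt hσ hi⟩ ⟨j + 1, mem_S_of_lt hσ hj⟩).1.1 hlt
    · simp only [dataOf]
      rw [hψ i hi, hψ j hj]
      exact (hφ ⟨i + 1, mem_S_of_lt hσ hi⟩ ⟨j + 1, mem_S_of_lt hσ hj⟩).2.1 hlt
  · rintro ⟨φ, hφ⟩
    have hmem : ∀ p : σ.S, 1 ≤ (p : ℕ) ∧ (p : ℕ) - 1 < σ.length := fun p => by
      have := bounds_of_mem_S hσ p.2
      omega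
    have hU : ∀ p q : σ.S, (σ.P p).1 < (σ.P q).1 →
        (π.P (φ (p - 1) + 1)).1 < (π.P (φ (q - 1) + 1)).1 := fun p q hlt => by
      refine hφ.U_lt _ (hmem p).2 _ (hmem q).2 ?_
      simpa only [dataOf, Nat.sub_add_cancel (hmem _).1] using hlt
    have hV : ∀ p q : σ.S, (σ.P p).2 < (σ.P q).2 →
        (π.P (φ (p - 1) + 1)).2 < (π.P (φ (q - 1) + 1)).2 := fun p q hlt => by
      refine hφ.V_lt _ (hmem p).2 _ (hmem q).2 ?_
      simpa only [dataOf, Nat.sub_add_cancel (hmem _).1] using hlt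
    refine ⟨fun p => ⟨φ (p - 1) + 1, mem_S_of_lt hπ (hφ.lt _ (hmem p).2)⟩,
      fun p q => ⟨⟨hU p q, fun hlt => ?_⟩, hV p q, fun hlt => ?_⟩⟩
    · by_contra hcon
      rcases (not_lt.1 hcon).lt_or_eq with h | h
      · exact lt_asymm hlt (hU q p h)
      · obtain rfl : p = q := Subtype.ext (σ.injOn_fst p p.2 q q.2 h.symm)
        exact lt_irrefl _ hlt
    · by_contra hcon
      rcases (not_lt.1 hcon).lt_or_eq with h | h
      · exact lt_asymm hlt (hV q p h)
      · obtain rfl : p = q := Subtype.ext (σ.injOn_snd p p.2 q q.2 h.symm)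
        exact lt_irrefl _ hlt

theorem success_iff {σ π : PointPerm} (hσ : σ.IsReduced) (hπ : π.IsReduced) :
    (dataOf σ π).l ≤ (dataOf σ π).n ∧ Success (dataOf σ π) ↔ σ.IsSubpattern π := by
  have hP := perms_dataOf hσ hπ
  rw [isSubpattern_iff hσ hπ]
  exact ⟨fun h => h.2.exists_strictEmbedding hP,
    fun ⟨_, h⟩ => ⟨h.length_le hP, h.success hP⟩⟩

/-! ### The encoded instance in memory -/

theorem length_toArray (π : PointPerm) : π.toArray.length = 2 * π.length := by
  simp [PointPerm.toArray, List.length_flatMap, Nat.mul_comm]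

theorem getD_flatMap_pair (f g : ℕ → ℕ) {n i : ℕ} (hi : i < n) :
    ((List.range n).flatMap fun i => [f i, g i]).getD (2 * i) 0 = f i ∧
      ((List.range n).flatMap fun i => [f i, g i]).getD (2 * i + 1) 0 = g i := by
  induction n with
  | zero => omega
  | succ n ih =>
    have hlen : ((List.range n).flatMap fun i => [f i, g i]).length = 2 * n := by
      simp [List.length_flatMap, Nat.mul_comm]
    rw [List.range_succ, List.flatMap_append]
    rcases Nat.lt_succ_iff_lt_or_eq.mp hi with hlt | rfl
    · rw [List.getD_append _ _ _ _ (by omega), List.getD_append _ _ _ _ (by omega)]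
      exact ih hlt
    · rw [List.getD_append_right _ _ _ _ (by omega), List.getD_append_right _ _ _ _ (by omega),
        hlen]
      simp

theorem input_encodeInstance {σ π : PointPerm} (hσ : σ.IsReduced) (hπ : π.IsReduced) :
    Input (dataOf σ π) fun a => (PointPerm.encodeInstance σ π).getD a 0 := by
  have hget : ∀ a, (PointPerm.encodeInstance σ π).getD (2 + a) 0 =
      (σ.toArray ++ π.toArray).getD a 0 := fun a => by
    rw [Nat.add_comm]
    rfl
  have hleft : ∀ a < 2 * σ.length, (PointPerm.encodeInstance σ π).getD (2 + a) 0 =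
      σ.toArray.getD a 0 := fun a ha => by
    rw [hget, List.getD_append _ _ _ _ (by rwa [length_toArray])]
  have hright : ∀ a, (PointPerm.encodeInstance σ π).getD (2 + 2 * σ.length + a) 0 =
      π.toArray.getD a 0 := fun a => by
    rw [Nat.add_assoc, hget, List.getD_append_right _ _ _ _ (by rw [length_toArray]; omega),
      length_toArray, Nat.add_sub_cancel_left]
  have hlen : (PointPerm.encodeInstance σ π).length = 2 + 2 * σ.length + 2 * π.length := by
    simp [PointPerm.encodeInstance, length_toArray]; omega
  refine ⟨rfl, rfl, fun i hi => ?_, fun i hi => ?_, fun q hq => ?_, fun q hq => ?_, fun a => ?_,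
    fun a ha => ?_⟩
  · simp only [dataOf] at hi ⊢
    rw [hleft _ (by omega)]
    exact (getD_flatMap_pair _ _ hi).1
  · simp only [dataOf] at hi ⊢
    rw [Nat.add_assoc, hleft _ (by omega)]
    exact (getD_flatMap_pair _ _ hi).2
  · simp only [dataOf] at hq ⊢
    rw [hright]
    exact (getD_flatMap_pair _ _ hq).1
  · simp only [dataOf] at hq ⊢
    rw [Nat.add_assoc (2 + 2 * σ.length), hright]
    exact (getD_flatMap_pair _ _ hq).2
  · have harr : ∀ π : PointPerm, π.IsReduced → ∀ x ∈ π.toArray, x ≤ π.length := fun π h x hx => by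
      simp only [PointPerm.toArray, List.mem_flatMap, List.mem_range, List.mem_cons,
        List.not_mem_nil, or_false] at hx
      obtain ⟨i, hi, rfl | rfl⟩ := hx
      · exact (coord_mem h hi).1.2
      · exact (coord_mem h hi).2.2
    have hall : ∀ x ∈ PointPerm.encodeInstance σ π, x ≤ (dataOf σ π).space := fun x hx => by
      simp only [PointPerm.encodeInstance, List.mem_cons, List.mem_append] at hx
      simp only [Data.space, dataOf]
      rcases hx with rfl | rfl | hx | hx
      · omega
      · omega
      · have := harr σ hσ x hx; omega
      · have := harr π hπ x hx; omega
    show (PointPerm.encodeInstance σ π).getD a 0 ≤ _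
    rcases lt_or_ge a (PointPerm.encodeInstance σ π).length with h | h
    · rw [List.getD_eq_getElem _ _ h]
      exact hall _ (List.getElem_mem h)
    · rw [List.getD_eq_default _ _ h]
      exact Nat.zero_le _
  · exact List.getD_eq_default _ _ (by rw [hlen]; exact ha)

/-! ### The running time and the theorem -/

theorem time_le {I : Data} (hl : I.l ≤ I.n) (hn : 1 ≤ I.n) :
    I.n ^ (I.l / 2) * (I.roundTime + 2) + 6 * (I.l / 2) + 19 + 1 ≤ 100 * I.n ^ (I.l / 2 + 2) := by
  -- With `l ≤ n` the quadratic term of a round is at most 55n², and `1 ≤ n` absorbs the rest into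
  -- 73n². The set-up and the last steps fit into the remaining 27n^(l/2+2).
  have h1 : I.roundTime + 2 ≤ 73 * I.n ^ 2 := by
    have h2 : I.l * (19 * I.l + 16 * I.n + 20) ≤ I.n * (55 * I.n) :=
      Nat.mul_le_mul hl (by omega)
    have h3 : I.n * 1 ≤ I.n * I.n := Nat.mul_le_mul_left _ hn
    have h4 : I.n * (55 * I.n) = 55 * (I.n * I.n) := by ring
    rw [Data.roundTime, sq]
    omega
  have h5 : I.n ^ 1 ≤ I.n ^ (I.l / 2 + 2) := Nat.pow_le_pow_right hn (by omega)
  have h6 : I.n ^ (I.l / 2) * (I.roundTime + 2) ≤ I.n ^ (I.l / 2) * (73 * I.n ^ 2) :=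
    Nat.mul_le_mul_left _ h1
  have h7 : I.n ^ (I.l / 2) * (73 * I.n ^ 2) = 73 * I.n ^ (I.l / 2 + 2) := by ring
  rw [pow_one] at h5
  omega

end PatternSearch

open PatternSearch in
theorem theoremt :
    ∃ (prog : RAM.Program) (C : ℝ) (f : ℕ → ℝ) (s : Polynomial ℕ),
      f =o[atTop] (fun l : ℕ => (l : ℝ)) ∧
      ∀ σ π : PointPerm, σ.IsReduced → π.IsReduced →
        (∃ (t : ℕ) (ans : Bool),
          RAM.HaltsWithin prog (PointPerm.encodeInstance σ π) t ans ∧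
          (ans = true ↔ σ.IsSubpattern π) ∧
          (1 ≤ π.length →
            (t : ℝ) ≤ C * (π.length : ℝ) ^ ((σ.length : ℝ) / 2 + f σ.length))) ∧
        RAM.RunsInSpace prog (PointPerm.encodeInstance σ π) (s.eval (σ.length + π.length)) := by
  -- The constant `f = 2` accounts for the O(n²) steps per guess; the polynomial is `Data.space`.
  refine ⟨search.withAnswer 8, 100, fun _ => 2, Polynomial.C 10 * Polynomial.X + Polynomial.C 20,
    ?_, fun σ π hσ hπ => ?_⟩
  · refine isLittleO_const_left.2 (Or.inr ?_)
    exact tendsto_norm_atTop_atTop.comp tendsto_natCast_atTop_atTop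
  obtain ⟨⟨t, v, ⟨hv, hgt, hle⟩, hhalt⟩, hspace⟩ := RAM.WP.haltsWithin (r := 8)
    (Q := fun v t => (0 < v ↔ (dataOf σ π).l ≤ (dataOf σ π).n ∧ Success (dataOf σ π)) ∧
      ((dataOf σ π).n < (dataOf σ π).l → t ≤ 4) ∧
      ((dataOf σ π).l ≤ (dataOf σ π).n → t ≤ (dataOf σ π).n ^ ((dataOf σ π).l / 2) *
        ((dataOf σ π).roundTime + 2) + 6 * ((dataOf σ π).l / 2) + 19))
    (wp_search (perms_dataOf hσ hπ).toValid (input_encodeInstance hσ hπ))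
  refine ⟨⟨t + 1, _, hhalt, ?_, fun hn => ?_⟩, ?_⟩
  · rw [decide_eq_true_iff, hv]
    exact success_iff hσ hπ
  · have hn' : (1 : ℝ) ≤ π.length := by exact_mod_cast hn
    rcases lt_or_ge π.length σ.length with hlt | hge
    · have ht : t + 1 ≤ 5 := by have := hgt hlt; omega
      have ht' : ((t + 1 : ℕ) : ℝ) ≤ 5 := by exact_mod_cast ht
      have := Real.one_le_rpow hn' (show (0 : ℝ) ≤ (σ.length : ℝ) / 2 + 2 by positivity)
      linarith
    · have ht : t + 1 ≤ 100 * π.length ^ (σ.length / 2 + 2) :=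
        (Nat.add_le_add_right (hle hge) 1).trans (time_le (I := dataOf σ π) hge hn)
      have ht' : ((t + 1 : ℕ) : ℝ) ≤ 100 * (π.length : ℝ) ^ (σ.length / 2 + 2) := by
        exact_mod_cast ht
      refine ht'.trans (mul_le_mul_of_nonneg_left ?_ (by norm_num))
      rw [← Real.rpow_natCast]
      refine Real.rpow_le_rpow_of_exponent_le hn' ?_
      push_cast
      have : ((σ.length / 2 : ℕ) : ℝ) ≤ (σ.length : ℝ) / 2 := Nat.cast_div_le
      linarith
  · simpa [Data.space, dataOf] using hspace
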